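/- **Setting.** Let $\mathcal H$ and $\mathcal H_{\rm aux}$ be complex Hilbert spaces (signal mode and local-oscillator mode), each with a fixed orthonormal basis $\{|n\rangle : n=0,1,2,\dots\}$ of number states. For $z\in\mathbb C$ let $|z\rangle=e^{-|z|^2/2}\sum_{n\ge 0}\frac{z^n}{\sqrt{n!}}|n\rangle$ be the coherent state. Let $U$ be the unitary operator on $\mathcal H\otimes\mathcal H_{\rm aux}$ (the $50:50$ beam splitter) with $$U\,|\alpha\rangle\otimes|\beta\rangle=\big|\tfrac{1}{\sqrt2}(\alpha-\beta)\big\rangle\otimes\big|\tfrac1{\sqrt2}(\alpha+\beta)\big\rangle\qquad(\alpha,\beta\in\mathbb C),$$ and let $V_z:\mathcal H\to\mathcal H\otimes\mathcal H_{\rm aux}$, $V_z\varphi=\varphi\otimes|z\rangle$. An *observable* is a map $\mathsf E$ from the Borel sets of $\mathbb R$ to the bounded operators on $\mathcal H$ with $\mathsf E(X)\ge 0$, $\mathsf E(\mathbb R)=1$, and $\sigma$-additive in the weak operator topology. A sequence of observables $\mathsf E^k$ *converges to an observable $\mathsf E$ weakly in the sense of probabilities* if $\mathsf E^k(X)\to\mathsf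 E(X)$ in the weak operator topology for every Borel set $X$ with $\mathsf E(\partial X)=0$. *Signal observable.* For a detector efficiency $\epsilon\in(0,1]$ put $E^{\epsilon}_n=\sum_{m\ge n}\binom mn\epsilon^n(1-\epsilon)^{m-n}|m\rangle\langle m|$, $n\in\mathbb N$. For $\epsilon_1,\epsilon_2\in(0,1]$ and $z\neq0$ the signal observable of the inefficient balanced homodyne detector is $$\mathsf E^z_{\epsilon_1,\epsilon_2}(X)=V_z^*U^*\Big(\sum E^{\epsilon_1}_m\otimes E^{\epsilon_2}_n\Big)UV_z ,$$ where the sum (in the weak operator topology) is over those $m,n\in\mathbb N$ with $\frac1{\sqrt2|z|}\big(\frac n{\epsilon_2}-\frac m{\epsilon_1}\big)\in X$. *Limit observable.* Let $a^*,a,N$ be the creation, annihilation and number operators of $\mathcal H$, let $\mathsf Q$ be the spectral measure of the closure of $\frac1{\sqrt2}(a^*+a)$, and let $\mathsf Q_\theta(X)=e^{i\theta N}\mathsf Q(X)e^{-i\theta N}$. Let $\mu_{\epsilon_1,\epsilon_2}$ be the probability measure on $\mathbb R$ with density $$f_{\epsilon_1,\epsilon_2}(x)=\sqrt{\tfrac{2\epsilon_1\epsilon_2}{\pi(\epsilon_1-2\epsilon_1\epsilon_2+\epsilon_2)}}\;e^{-\frac{2\epsilon_1\epsilon_2}{\epsilon_1-2\epsilon_1\epsilon_2+\epsilon_2}x^2}$$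 if $\epsilon_1<1$ or $\epsilon_2<1$, and let $\mu_{1,1}$ be the Dirac measure at $0$. Put $(\mu_{\epsilon_1,\epsilon_2}*\mathsf Q_\theta)(X)=\int\mu_{\epsilon_1,\epsilon_2}(X-x)\,d\mathsf Q_\theta(x)$ (a weak integral); in particular $\mu_{1,1}*\mathsf Q_\theta=\mathsf Q_\theta$. **Proposition.** Let $\epsilon_1,\epsilon_2\in(0,1]$, let $\theta\in\mathbb R$, let $(r_k)_{k\in\mathbb N}$ be any sequence of positive numbers with $r_k\to\infty$, and put $z_k=r_ke^{i\theta}$. Then the sequence of observables $(\mathsf E^{z_k}_{\epsilon_1,\epsilon_2})_{k\in\mathbb N}$ converges to the observable $\mu_{\epsilon_1,\epsilon_2}*\mathsf Q_\theta$ weakly in the sense of probabilities. -/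

import Mathlib

open MeasureTheory Filter Topology
open scoped InnerProductSpace TensorProduct ENNReal FourierTransform

namespace Homodyne
noncomputable section

/-- The `n`-th Hermite function. -/
def hermiteFun (n : ℕ) (x : ℝ) : ℝ :=
  (√(√Real.pi * n.factorial))⁻¹ * Polynomial.aeval (√2 * x) (Polynomial.hermite n) * Real.exp (-x ^ 2 / 2)

theorem integrable_poly_gauss (P : Polynomial ℝ) :
    Integrable fun x : ℝ => P.eval x * Real.exp (-(x ^ 2 / 2)) := by
  induction P using Polynomial.induction_on' with
  | add p q hp hq =>
    refine (hp.add hq).congr (ae_of_all _ fun x => ?_)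
    simp [add_mul]
  | monomial n a =>
    have h := integrable_rpow_mul_exp_neg_mul_sq (b := 1 / 2) (by norm_num) (s := n)
      (by have : (0:ℝ) ≤ n := by positivity
          linarith)
    simp only [Real.rpow_natCast] at h
    convert h.const_mul a using 2 with x
    simp only [Polynomial.eval_monomial]
    ring_nf

def he (n : ℕ) : Polynomial ℝ := (Polynomial.hermite n).map (Int.castRingHom ℝ)

theorem he_succ (n : ℕ) : he (n + 1) = Polynomial.X * he n - (he n).derivative := by
  simp [he, Polynomial.hermite_succ, Polynomial.derivative_map]

theorem he_parts (P : Polynomial ℝ) (n : ℕ) :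
    ∫ x : ℝ, P.eval x * (he (n + 1)).eval x * Real.exp (-(x ^ 2 / 2)) =
      ∫ x : ℝ, P.derivative.eval x * (he n).eval x * Real.exp (-(x ^ 2 / 2)) := by
  have hd : ∀ x : ℝ, HasDerivAt (fun x => (P * he n).eval x * Real.exp (-(x ^ 2 / 2)))
      ((P.derivative * he n - P * he (n + 1)).eval x * Real.exp (-(x ^ 2 / 2))) x := by
    intro x
    have h1 := (P * he n).hasDerivAt x
    have h2 : HasDerivAt (fun x : ℝ => Real.exp (-(x ^ 2 / 2)))
        (Real.exp (-(x ^ 2 / 2)) * (-x)) x := by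
      have h3 : HasDerivAt (fun x : ℝ => -(x ^ 2 / 2)) (-x) x := by
        exact ((hasDerivAt_pow 2 x).div_const 2).neg.congr_deriv (by simp)
      exact h3.exp
    refine (h1.mul h2).congr_deriv ?_
    simp only [he_succ, Polynomial.derivative_mul, Polynomial.eval_sub, Polynomial.eval_add,
      Polynomial.eval_mul, Polynomial.eval_X]
    ring
  have h0 := integral_eq_zero_of_hasDerivAt_of_integrable hd
    (integrable_poly_gauss _) (integrable_poly_gauss _)
  have e : ∀ x : ℝ, (P.derivative * he n - P * he (n + 1)).eval x * Real.exp (-(x ^ 2 / 2)) =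
      (P.derivative * he n).eval x * Real.exp (-(x ^ 2 / 2)) -
        (P * he (n + 1)).eval x * Real.exp (-(x ^ 2 / 2)) := by
    intro x; simp [sub_mul]
  simp_rw [e] at h0
  rw [integral_sub (integrable_poly_gauss _) (integrable_poly_gauss _), sub_eq_zero] at h0
  simp only [Polynomial.eval_mul] at h0
  exact h0.symm

theorem he_iter (P : Polynomial ℝ) (n : ℕ) :
    ∫ x : ℝ, P.eval x * (he n).eval x * Real.exp (-(x ^ 2 / 2)) =
      ∫ x : ℝ, (Polynomial.derivative^[n] P).eval x * Real.exp (-(x ^ 2 / 2)) := by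
  induction n generalizing P with
  | zero => simp [he]
  | succ n ih => rw [he_parts, ih]; rfl

theorem he_monic (n : ℕ) : (he n).Monic := (Polynomial.hermite_monic n).map _

theorem he_natDegree (n : ℕ) : (he n).natDegree = n := by
  rw [he, (Polynomial.hermite_monic n).natDegree_map, Polynomial.natDegree_hermite]

theorem gauss_integral : ∫ x : ℝ, Real.exp (-(x ^ 2 / 2)) = √(2 * Real.pi) := by
  have := integral_gaussian (1 / 2)
  rw [← show Real.pi / (1 / 2) = 2 * Real.pi by ring, ← this]
  congr 1; ext x; ring_nf

theorem he_self (n : ℕ) :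
    ∫ x : ℝ, (he n).eval x * (he n).eval x * Real.exp (-(x ^ 2 / 2)) =
      n.factorial * √(2 * Real.pi) := by
  rw [he_iter]
  have h : Polynomial.derivative^[n] (he n) = Polynomial.C (n.factorial : ℝ) := by
    have h1 := Polynomial.natDegree_iterate_derivative (he n) n
    rw [he_natDegree, Nat.sub_self] at h1
    rw [Polynomial.eq_C_of_natDegree_le_zero h1, Polynomial.coeff_iterate_derivative]
    have := (he_monic n).coeff_natDegree
    rw [he_natDegree] at this
    simp [this, Nat.descFactorial_self]
  simp [h, integral_const_mul, gauss_integral]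

theorem he_lt {m n : ℕ} (h : m < n) :
    ∫ x : ℝ, (he m).eval x * (he n).eval x * Real.exp (-(x ^ 2 / 2)) = 0 := by
  rw [he_iter, Polynomial.iterate_derivative_eq_zero (by rwa [he_natDegree])]
  simp

theorem he_orth (m n : ℕ) :
    ∫ x : ℝ, (he m).eval x * (he n).eval x * Real.exp (-(x ^ 2 / 2)) =
      if m = n then n.factorial * √(2 * Real.pi) else 0 := by
  rcases lt_trichotomy m n with h | h | h
  · simp [he_lt h, h.ne]
  · subst h; simp [he_self]
  · rw [if_neg h.ne', ← he_lt h]; congr 1; ext x; ring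

theorem hermiteFun_eq (n : ℕ) (x : ℝ) : hermiteFun n x =
    (√(√Real.pi * n.factorial))⁻¹ * (he n).eval (√2 * x) * Real.exp (-x ^ 2 / 2) := by
  simp [hermiteFun, he, Polynomial.aeval_def, Polynomial.eval_map]

theorem hermiteFun_orth (m n : ℕ) :
    ∫ x : ℝ, hermiteFun m x * hermiteFun n x = if m = n then 1 else 0 := by
  have e : ∀ x, hermiteFun m x * hermiteFun n x = ((√(√Real.pi * m.factorial))⁻¹ * (√(√Real.pi * n.factorial))⁻¹) *
      (fun y => (he m).eval y * (he n).eval y * Real.exp (-(y ^ 2 / 2))) (√2 * x) := by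
    intro x
    simp only [hermiteFun_eq]
    have : Real.exp (-((√2 * x) ^ 2 / 2)) = Real.exp (-x ^ 2 / 2) * Real.exp (-x ^ 2 / 2) := by
      rw [← Real.exp_add, mul_pow, Real.sq_sqrt (by norm_num)]; ring_nf
    rw [this]; ring
  simp_rw [e]
  rw [integral_const_mul, Measure.integral_comp_mul_left
    (fun y => (he m).eval y * (he n).eval y * Real.exp (-(y ^ 2 / 2))), he_orth]
  split_ifs with h
  · subst h
    have h1 : (√(√Real.pi * m.factorial))⁻¹ * (√(√Real.pi * m.factorial))⁻¹ = (√Real.pi * m.factorial)⁻¹ := by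
      rw [← mul_inv, Real.mul_self_sqrt (by positivity)]
    rw [h1, abs_of_pos (by positivity), Real.sqrt_mul (by norm_num), smul_eq_mul]
    have : (0:ℝ) < √Real.pi := Real.sqrt_pos.2 Real.pi_pos
    field_simp
  · simp

theorem continuous_hermiteFun (n : ℕ) : Continuous (hermiteFun n) := by
  have : hermiteFun n = fun x => (√(√Real.pi * n.factorial))⁻¹ * (he n).eval (√2 * x) * Real.exp (-x ^ 2 / 2) :=
    funext (hermiteFun_eq n)
  rw [this]
  fun_prop

theorem memLp_hermiteFun (n : ℕ) : MemLp (fun x : ℝ => (hermiteFun n x : ℂ)) 2 volume := by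
  have hc := continuous_hermiteFun n
  rw [memLp_two_iff_integrable_sq_norm (by fun_prop)]
  by_contra hI
  have h := hermiteFun_orth n n
  have e : (fun x => hermiteFun n x * hermiteFun n x) = fun x => ‖(hermiteFun n x : ℂ)‖ ^ 2 := by
    ext x; simp [sq]
  rw [e, integral_undef hI] at h
  simp at h

theorem orthonormal_hermite :
    Orthonormal ℂ fun n => (memLp_hermiteFun n).toLp := by
  rw [orthonormal_iff_ite]
  intro m n
  rw [L2.inner_def]
  have : ∫ x, ⟪((memLp_hermiteFun m).toLp : Lp ℂ 2 volume) x, ((memLp_hermiteFun n).toLp : Lp ℂ 2 volume) x⟫_ℂ =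
      ∫ x, ((hermiteFun m x * hermiteFun n x : ℝ) : ℂ) := by
    apply integral_congr_ae
    filter_upwards [(memLp_hermiteFun m).coeFn_toLp, (memLp_hermiteFun n).coeFn_toLp] with x h1 h2
    rw [h1, h2]; simp [mul_comm]
  rw [this, integral_complex_ofReal, hermiteFun_orth]
  split_ifs <;> simp

theorem ae_zero_of_moments (g : ℝ → ℂ) (hm : AEStronglyMeasurable g volume)
    (hi : ∀ t : ℝ, Integrable fun x => Real.exp (t * |x|) * ‖g x‖)
    (h0 : ∀ n : ℕ, ∫ x : ℝ, (x : ℂ) ^ n * g x = 0) : g =ᵐ[volume] 0 := by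
  have hg : Integrable g := by
    rw [← integrable_norm_iff hm]; simpa using hi 0
  -- vanishing Fourier transform
  have hF : ∀ ξ : ℝ, ∫ x : ℝ, Complex.exp ((ξ * x : ℝ) * Complex.I) * g x = 0 := by
    intro ξ
    have hs := hasSum_integral_of_dominated_convergence (μ := (volume : Measure ℝ))
      (F := fun (n : ℕ) (x : ℝ) => (((ξ * x : ℝ) * Complex.I) ^ n / n.factorial : ℂ) * g x)
      (f := fun x => Complex.exp ((ξ * x : ℝ) * Complex.I) * g x)
      (fun n x => (|ξ * x| ^ n / n.factorial) * ‖g x‖) (fun n => by fun_prop)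
      (fun n => ae_of_all _ fun x => by simp [abs_mul])
      (ae_of_all _ fun x => (Real.summable_pow_div_factorial _).mul_right _)
      (by
        refine (hi |ξ|).congr (ae_of_all _ fun x => ?_)
        beta_reduce
        rw [tsum_mul_right, ← abs_mul, Real.exp_eq_exp_ℝ, NormedSpace.exp_eq_tsum_div])
      (ae_of_all _ fun x => by
        have := NormedSpace.expSeries_div_hasSum_exp (𝔸 := ℂ) ((ξ * x : ℝ) * Complex.I)
        rw [← Complex.exp_eq_exp_ℂ] at this
        exact this.mul_right _)
    have hz : ∀ n : ℕ, ∫ x : ℝ, (((ξ * x : ℝ) * Complex.I) ^ n / n.factorial : ℂ) * g x = 0 := by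
      intro n
      have : ∀ x : ℝ, (((ξ * x : ℝ) * Complex.I) ^ n / n.factorial : ℂ) * g x =
          ((ξ * Complex.I) ^ n / n.factorial) * ((x : ℂ) ^ n * g x) := by
        intro x; push_cast; ring
      simp_rw [this]
      rw [integral_const_mul, h0, mul_zero]
    simp_rw [hz] at hs
    exact hs.unique hasSum_zero
  have hF' : 𝓕 g = 0 := by
    ext w
    rw [Real.fourier_real_eq_integral_exp_smul]
    have := hF (-2 * Real.pi * w)
    simp only [Pi.zero_apply]
    rw [← this]
    congr 1; ext x
    rw [smul_eq_mul]; congr 3; push_cast; ring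
  apply ae_eq_zero_of_integral_contDiff_smul_eq_zero hg.locallyIntegrable
  intro φ hφ hφc
  have hc : HasCompactSupport (fun x => (φ x : ℂ)) := hφc.comp_left (g := fun r : ℝ => (r:ℂ)) (by simp)
  let S : SchwartzMap ℝ ℂ := hc.toSchwartzMap (Complex.ofRealCLM.contDiff.comp hφ)
  let T : SchwartzMap ℝ ℂ := 𝓕⁻ S
  have hT : (𝓕 (T : ℝ → ℂ)) = S := by
    rw [← SchwartzMap.fourier_coe]
    simp [T]
  have key := VectorFourier.integral_fourierIntegral_smul_eq_flip (μ := (volume : Measure ℝ))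
    (ν := (volume : Measure ℝ)) (L := innerₗ ℝ) (e := Real.fourierChar) (f := (T : ℝ → ℂ)) (g := g)
    Real.continuous_fourierChar (by exact continuous_inner) T.integrable hg
  have e1 : VectorFourier.fourierIntegral Real.fourierChar volume (innerₗ ℝ) (T : ℝ → ℂ) = S := hT
  have e2 : VectorFourier.fourierIntegral Real.fourierChar volume (innerₗ ℝ).flip g = 0 := by
    rw [flip_innerₗ]; exact hF'
  rw [e1, e2] at key
  simp only [Pi.zero_apply, smul_zero, integral_zero] at key
  exact key

theorem memLp_exp_gauss (t : ℝ) :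
    MemLp (fun x : ℝ => Real.exp (t * |x|) * Real.exp (-x ^ 2 / 2)) 2 volume := by
  have hc : Continuous fun x : ℝ => Real.exp (t * |x|) * Real.exp (-x ^ 2 / 2) := by fun_prop
  rw [memLp_two_iff_integrable_sq_norm hc.aestronglyMeasurable]
  have hI := ((integrable_poly_gauss 1).const_mul (Real.exp (2 * t ^ 2)))
  simp only [Polynomial.eval_one, one_mul] at hI
  refine hI.mono' (by fun_prop) (ae_of_all _ fun x => ?_)
  rw [Real.norm_of_nonneg (by positivity), Real.norm_of_nonneg (by positivity), ← Real.exp_add,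
    ← Real.exp_add, ← Real.exp_nat_mul, Real.exp_le_exp]
  have := sq_abs x
  push_cast
  nlinarith [sq_nonneg (2 * t - |x|)]

theorem integrable_weighted (u : Lp ℂ 2 (volume : Measure ℝ)) (t : ℝ) :
    Integrable fun x : ℝ => Real.exp (t * |x|) * Real.exp (-x ^ 2 / 2) * ‖u x‖ :=
  (memLp_exp_gauss t).integrable_mul (Lp.memLp u).norm

theorem aestronglyMeasurable_pos (v : Lp ℂ 2 (volume : Measure ℝ)) :
    AEStronglyMeasurable (fun x : ℝ => (x : ℂ) * v x) volume :=
  (by fun_prop : AEStronglyMeasurable (fun x : ℝ => (x : ℂ)) volume).mul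
    (Lp.aestronglyMeasurable v)

theorem integrable_weighted' (u v : Lp ℂ 2 (volume : Measure ℝ)) (t : ℝ) :
    Integrable fun x : ℝ =>
      Real.exp (t * |x|) * ‖(Real.exp (-x ^ 2 / 2) : ℂ) * (u x + x * v x)‖ := by
  have h := (integrable_weighted u t).add (integrable_weighted v (t + 1))
  have hu := Lp.aestronglyMeasurable u
  have hv := aestronglyMeasurable_pos v
  refine h.mono' ?_ (ae_of_all _ fun x => ?_)
  · exact (by fun_prop : AEStronglyMeasurable (fun x : ℝ => Real.exp (t * |x|)) volume).mul
      ((by fun_prop : AEStronglyMeasurable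
        (fun x : ℝ => (Real.exp (-x ^ 2 / 2) : ℂ)) volume).mul (hu.add hv)).norm
  · have h1 : |x| ≤ Real.exp |x| := (by linarith : |x| ≤ |x| + 1).trans (Real.add_one_le_exp _)
    have h2 : Real.exp ((t + 1) * |x|) = Real.exp (t * |x|) * Real.exp |x| := by
      rw [← Real.exp_add]; ring_nf
    have h3 : ‖u x + x * v x‖ ≤ ‖u x‖ + Real.exp |x| * ‖v x‖ := by
      refine (norm_add_le _ _).trans (add_le_add le_rfl ?_)
      rw [norm_mul, Complex.norm_real, Real.norm_eq_abs]
      gcongr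
    rw [Real.norm_of_nonneg (by positivity), norm_mul, Complex.norm_real,
      Real.norm_of_nonneg (by positivity)]
    simp only [Pi.add_apply, h2]
    calc _ ≤ Real.exp (t * |x|) * (Real.exp (-x ^ 2 / 2) * (‖u x‖ + Real.exp |x| * ‖v x‖)) := by
          gcongr
      _ = _ := by ring

def heSeq : Polynomial.Sequence ℝ where
  elems' := he
  degree_eq' n := by
    rw [Polynomial.degree_eq_natDegree (he_monic n).ne_zero, he_natDegree]

theorem ae_zero_of_hermite (u v : Lp ℂ 2 (volume : Measure ℝ))
    (h : ∀ n, ∫ x, (hermiteFun n x : ℂ) * (u x + x * v x) = 0) :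
    (fun x => u x + x * v x) =ᵐ[volume] 0 := by
  set G : ℝ → ℂ := fun x => (Real.exp (-x ^ 2 / 2) : ℂ) * (u x + x * v x) with hG
  have hm : AEStronglyMeasurable G volume :=
    (by fun_prop : AEStronglyMeasurable
        (fun x : ℝ => (Real.exp (-x ^ 2 / 2) : ℂ)) volume).mul
      ((Lp.aestronglyMeasurable u).add (aestronglyMeasurable_pos v))
  have hpow : ∀ n : ℕ, Integrable fun x : ℝ => (x : ℂ) ^ n * G x := by
    intro n
    refine ((integrable_weighted' u v 1).const_mul (n.factorial : ℝ)).mono'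
      ((by fun_prop : AEStronglyMeasurable (fun x : ℝ => (x : ℂ) ^ n) volume).mul hm)
      (ae_of_all _ fun x => ?_)
    rw [norm_mul, norm_pow, Complex.norm_real, Real.norm_eq_abs, ← mul_assoc, one_mul]
    gcongr
    have := Real.pow_div_factorial_le_exp _ (abs_nonneg x) n
    rwa [div_le_iff₀ (by positivity), mul_comm] at this
  have hpoly : ∀ P : Polynomial ℝ, Integrable fun x : ℝ => ((P.eval (√2 * x) : ℝ) : ℂ) * G x := by
    intro P
    induction P using Polynomial.induction_on' with
    | add p q hp hq =>
      refine (hp.add hq).congr (ae_of_all _ fun x => ?_)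
      simp [add_mul]
    | monomial n a =>
      refine ((hpow n).const_mul ((a * √2 ^ n : ℝ) : ℂ)).congr (ae_of_all _ fun x => ?_)
      simp only [Polynomial.eval_monomial]
      push_cast
      ring
  let Λ : Polynomial ℝ →ₗ[ℝ] ℂ :=
    { toFun := fun P => ∫ x : ℝ, ((P.eval (√2 * x) : ℝ) : ℂ) * G x
      map_add' := fun p q => by
        rw [← integral_add (hpoly p) (hpoly q)]
        congr 1; ext x; simp [add_mul]
      map_smul' := fun a p => by
        simp only [Polynomial.eval_smul, smul_eq_mul, RingHom.id_apply, Complex.real_smul]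
        rw [← integral_const_mul]
        congr 1; ext x; push_cast; ring }
  have hΛ : Λ = 0 := by
    refine LinearMap.ext_on_range (v := heSeq) (heSeq.span fun i => ?_) fun n => ?_
    · rw [show heSeq i = he i from rfl, (he_monic i).leadingCoeff]; exact isUnit_one
    · have h1 := h n
      have : ∀ x : ℝ, (hermiteFun n x : ℂ) * (u x + x * v x) =
          ((√(√Real.pi * n.factorial))⁻¹ : ℝ) * ((((he n).eval (√2 * x) : ℝ) : ℂ) * G x) := by
        intro x; rw [hermiteFun_eq, hG]; push_cast; ring
      simp_rw [this] at h1
      rw [integral_const_mul] at h1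
      refine (mul_eq_zero.1 h1).resolve_left ?_
      have : (0:ℝ) < √(√Real.pi * n.factorial) :=
        Real.sqrt_pos.2 (mul_pos (Real.sqrt_pos.2 Real.pi_pos) (by positivity))
      exact_mod_cast (inv_pos.2 this).ne'
  have hz := ae_zero_of_moments G hm (integrable_weighted' u v) (fun n => by
    have h1 : Λ (Polynomial.X ^ n) = 0 := by rw [hΛ]; rfl
    have h2 : Λ (Polynomial.X ^ n) = ((√2 ^ n : ℝ) : ℂ) * ∫ x : ℝ, (x : ℂ) ^ n * G x := by
      rw [← integral_const_mul]
      change ∫ x : ℝ, _ = _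
      congr 1; ext x; simp; ring
    rw [h2] at h1
    refine (mul_eq_zero.1 h1).resolve_left ?_
    have : (0:ℝ) < √2 ^ n := by positivity
    exact_mod_cast this.ne')
  filter_upwards [hz] with x hx
  refine (mul_eq_zero.1 hx).resolve_left ?_
  exact_mod_cast (Real.exp_pos _).ne'

theorem inner_hermite (n : ℕ) (u : Lp ℂ 2 (volume : Measure ℝ)) :
    ⟪((memLp_hermiteFun n).toLp : Lp ℂ 2 volume), u⟫_ℂ = ∫ x, (hermiteFun n x : ℂ) * u x := by
  rw [L2.inner_def]
  apply integral_congr_ae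
  filter_upwards [(memLp_hermiteFun n).coeFn_toLp] with x h1
  rw [h1]; simp [mul_comm]

/-- The orthonormal basis of `L²(ℝ)` consisting of the Hermite functions. -/
def hermiteBasis : HilbertBasis ℕ ℂ (Lp ℂ 2 (volume : Measure ℝ)) :=
  HilbertBasis.mkOfOrthogonalEqBot orthonormal_hermite (by
    rw [Submodule.eq_bot_iff]
    intro u hu
    have h : ∀ n, ∫ x, (hermiteFun n x : ℂ) * u x = 0 := fun n => by
      rw [← inner_hermite]
      exact (Submodule.mem_orthogonal _ _).1 hu _ (Submodule.subset_span ⟨n, rfl⟩)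
    have h0 : (fun x : ℝ => (x : ℂ) * (0 : Lp ℂ 2 (volume : Measure ℝ)) x) =ᵐ[volume] 0 := by
      filter_upwards [Lp.coeFn_zero ℂ 2 (volume : Measure ℝ)] with x hx
      simp
    have h1 := ae_zero_of_hermite u 0 (fun n => by
      rw [← h n]
      apply integral_congr_ae
      filter_upwards [h0] with x hx
      have hx' : (x : ℂ) * (0 : Lp ℂ 2 (volume : Measure ℝ)) x = 0 := hx
      rw [hx', add_zero])
    rw [Lp.eq_zero_iff_ae_eq_zero]
    filter_upwards [h1, h0] with x hx hx0
    have hx' : (x : ℂ) * (0 : Lp ℂ 2 (volume : Measure ℝ)) x = 0 := hx0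
    simpa [hx'] using hx)

theorem he_derivative (n : ℕ) : (he (n + 1)).derivative = ((n : ℝ) + 1) • he n := by
  induction n with
  | zero => simp [he]
  | succ n ih =>
    rw [he_succ (n + 1), Polynomial.derivative_sub, Polynomial.derivative_mul,
      Polynomial.derivative_X, ih, Polynomial.derivative_smul]
    conv_rhs => rw [he_succ n]
    conv_lhs => rw [he_succ n]
    simp only [Polynomial.smul_eq_C_mul]
    push_cast
    simp only [Polynomial.C_add, Polynomial.C_1]
    ring

theorem hermiteFun_rec (n : ℕ) (x : ℝ) : x * hermiteFun n x =
    √((n + 1) / 2) * hermiteFun (n + 1) x + √(n / 2) * hermiteFun (n - 1) x := by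
  have hpi : (0:ℝ) < √Real.pi := Real.sqrt_pos.2 Real.pi_pos
  have h2 : √2 * √2 = (2:ℝ) := Real.mul_self_sqrt (by norm_num)
  have h2' : (0:ℝ) < √2 := by positivity
  have key : √((n + 1 : ℝ) / 2) * (√(√Real.pi * (n + 1).factorial))⁻¹ =
      (√2)⁻¹ * (√(√Real.pi * n.factorial))⁻¹ := by
    rw [Nat.factorial_succ, Real.sqrt_div (by positivity)]
    push_cast
    rw [show √Real.pi * ((n + 1 : ℝ) * n.factorial) = (n + 1 : ℝ) * (√Real.pi * n.factorial) by ring,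
      Real.sqrt_mul (by positivity)]
    have : (0:ℝ) < √(n + 1 : ℝ) := Real.sqrt_pos.2 (by positivity)
    field_simp
  cases n with
  | zero =>
    have h := he_succ 0
    have e1 : √((((0 : ℕ) : ℝ) + 1) / 2) * ((√(√Real.pi * (Nat.factorial (0 + 1))))⁻¹ *
        (he (0 + 1)).eval (√2 * x) * Real.exp (-x ^ 2 / 2)) =
        ((√2)⁻¹ * (√(√Real.pi * (Nat.factorial 0)))⁻¹) * (he (0 + 1)).eval (√2 * x) *
          Real.exp (-x ^ 2 / 2) := by rw [← key]; ring
    simp only [hermiteFun_eq]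
    rw [e1, h]
    simp [he]
    field_simp
  | succ m =>
    have key2 : √((m + 1 : ℝ) / 2) * (√(√Real.pi * m.factorial))⁻¹ =
        (√2)⁻¹ * (m + 1) * (√(√Real.pi * (m + 1).factorial))⁻¹ := by
      rw [Nat.factorial_succ, Real.sqrt_div (by positivity)]
      push_cast
      rw [show √Real.pi * ((m + 1 : ℝ) * m.factorial) =
        (m + 1 : ℝ) * (√Real.pi * m.factorial) by ring,
        Real.sqrt_mul (show (0:ℝ) ≤ m + 1 by positivity)]
      have h3 : (0:ℝ) < √(m + 1 : ℝ) := Real.sqrt_pos.2 (by positivity)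
      have h4 : √(m + 1 : ℝ) * √(m + 1 : ℝ) = m + 1 := Real.mul_self_sqrt (by positivity)
      have h5 : (m + 1 : ℝ) * (√(m + 1 : ℝ))⁻¹ = √(m + 1 : ℝ) := by
        rw [← div_eq_mul_inv, div_eq_iff h3.ne', h4]
      rw [mul_inv, ← mul_assoc, mul_assoc (√2)⁻¹, h5]
      ring
    have h := he_succ (m + 1)
    rw [he_derivative] at h
    simp only [hermiteFun_eq, Nat.add_sub_cancel]
    have e1 : √((((m + 1 : ℕ) : ℝ) + 1) / 2) * ((√(√Real.pi * (m + 1 + 1).factorial))⁻¹ *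
        (he (m + 1 + 1)).eval (√2 * x) * Real.exp (-x ^ 2 / 2)) =
        ((√2)⁻¹ * (√(√Real.pi * (m + 1).factorial))⁻¹) * (he (m + 1 + 1)).eval (√2 * x) *
          Real.exp (-x ^ 2 / 2) := by rw [← key]; ring
    have e2 : √(((m + 1 : ℕ) : ℝ) / 2) * ((√(√Real.pi * m.factorial))⁻¹ *
        (he m).eval (√2 * x) * Real.exp (-x ^ 2 / 2)) =
        ((√2)⁻¹ * (m + 1) * (√(√Real.pi * (m + 1).factorial))⁻¹) * (he m).eval (√2 * x) *
          Real.exp (-x ^ 2 / 2) := by rw [← key2]; push_cast; ring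
    rw [e1, e2, h]
    simp only [Polynomial.eval_sub, Polynomial.eval_mul, Polynomial.eval_X, Polynomial.eval_smul,
      smul_eq_mul]
    field_simp
    ring

/-- Multiplication by the (bounded measurable) function `g`, as an operator on `L²(ℝ)`;
the value is `0` if `g` is not essentially bounded. -/
def mulOp (g : ℝ → ℂ) : Lp ℂ 2 (volume : Measure ℝ) →L[ℂ] Lp ℂ 2 (volume : Measure ℝ) :=
  open Classical in
  if h : MemLp g ∞ volume then
    (ContinuousLinearMap.lsmul ℂ ℂ).holderL volume ∞ 2 2 (h.toLp g)
  else 0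

theorem coeFn_mulOp {g : ℝ → ℂ} (h : MemLp g ∞ volume) (f : Lp ℂ 2 (volume : Measure ℝ)) :
    mulOp g f =ᵐ[volume] fun x => g x * f x := by
  rw [mulOp, dif_pos h]
  have h1 := ContinuousLinearMap.coeFn_holder (r := 2) (ContinuousLinearMap.lsmul ℂ ℂ)
    (h.toLp g) f
  filter_upwards [h1, h.coeFn_toLp] with x hx hx'
  rw [ContinuousLinearMap.holderL_apply_apply, hx, hx']
  simp

theorem memLp_indicator_one {X : Set ℝ} (hX : MeasurableSet X) :
    MemLp (X.indicator fun _ => (1 : ℂ)) ∞ volume :=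
  (memLp_top_const (1 : ℂ)).indicator hX

theorem memLp_indicator_id (R : ℝ) :
    MemLp ((Set.Icc (-R) R).indicator fun x : ℝ => (x : ℂ)) ∞ volume := by
  refine memLp_top_of_bound ((by fun_prop : AEStronglyMeasurable
    (fun x : ℝ => (x : ℂ)) volume).indicator measurableSet_Icc) |R| (ae_of_all _ fun x => ?_)
  by_cases hx : x ∈ Set.Icc (-R) R
  · rw [Set.indicator_of_mem hx, Complex.norm_real, Real.norm_eq_abs]
    exact (abs_le.2 hx).trans (le_abs_self R)
  · rw [Set.indicator_of_notMem hx]; simp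

theorem isClosed_position_graph :
    IsClosed {p : Lp ℂ 2 (volume : Measure ℝ) × Lp ℂ 2 (volume : Measure ℝ) |
      p.2 =ᵐ[volume] fun x => (x : ℂ) * p.1 x} := by
  have : {p : Lp ℂ 2 (volume : Measure ℝ) × Lp ℂ 2 (volume : Measure ℝ) |
      p.2 =ᵐ[volume] fun x => (x : ℂ) * p.1 x} = ⋂ k : ℕ,
      {p | mulOp ((Set.Icc (-(k : ℝ)) k).indicator fun _ => (1 : ℂ)) p.2 =
        mulOp ((Set.Icc (-(k : ℝ)) k).indicator fun x : ℝ => (x : ℂ)) p.1} := by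
    ext p
    simp only [Set.mem_ofPred_eq, Set.mem_iInter]
    constructor
    · intro h k
      apply Lp.ext
      filter_upwards [h, coeFn_mulOp (memLp_indicator_one measurableSet_Icc) p.2,
        coeFn_mulOp (memLp_indicator_id k) p.1] with x h1 h2 h3
      rw [h2, h3, h1]
      by_cases hx : x ∈ Set.Icc (-(k : ℝ)) k
      · simp [Set.indicator_of_mem hx]
      · simp [Set.indicator_of_notMem hx]
    · intro h
      have h2 := ae_all_iff.2 fun k : ℕ =>
        coeFn_mulOp (memLp_indicator_one (X := Set.Icc (-(k : ℝ)) k) measurableSet_Icc) p.2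
      have h3 := ae_all_iff.2 fun k : ℕ => coeFn_mulOp (memLp_indicator_id k) p.1
      filter_upwards [h2, h3] with x h2 h3
      obtain ⟨k, hk⟩ := exists_nat_ge |x|
      have h2 := h2 k
      have h3 := h3 k
      rw [h k] at h2
      have hx : x ∈ Set.Icc (-(k : ℝ)) k := abs_le.1 hk
      rw [h2, Set.indicator_of_mem hx, Set.indicator_of_mem hx] at h3
      simpa using h3
  rw [this]
  exact isClosed_iInter fun k => isClosed_eq (by fun_prop) (by fun_prop)

section
variable {H : Type*} [NormedAddCommGroup H] [InnerProductSpace ℂ H]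

/-- The position representation: the unitary map `H → L²(ℝ)` that takes the number state `|n⟩`
to the `n`-th Hermite function. -/
def positionRep (b : HilbertBasis ℕ ℂ H) : H ≃ₗᵢ[ℂ] Lp ℂ 2 (volume : Measure ℝ) :=
  b.repr.trans hermiteBasis.repr.symm

theorem positionRep_number (b : HilbertBasis ℕ ℂ H) (n : ℕ) :
    positionRep b (b n) = (memLp_hermiteFun n).toLp := by
  classical
  simp only [positionRep, LinearIsometryEquiv.trans_apply, b.repr_self]
  rw [HilbertBasis.repr_symm_single]
  simp [hermiteBasis]

theorem positionRep_quadrature (b : HilbertBasis ℕ ℂ H) (n : ℕ) :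
    positionRep b (((√2)⁻¹ : ℂ) • ((√(n + 1) : ℂ) • b (n + 1) + (√n : ℂ) • b (n - 1)))
      =ᵐ[volume] fun x => (x : ℂ) * hermiteFun n x := by
  simp only [map_smul, map_add, positionRep_number]
  filter_upwards [Lp.coeFn_smul ((√2)⁻¹ : ℂ) ((√(n + 1) : ℂ) • (memLp_hermiteFun (n + 1)).toLp +
      (√n : ℂ) • (memLp_hermiteFun (n - 1)).toLp : Lp ℂ 2 (volume : Measure ℝ)),
    Lp.coeFn_add ((√(n + 1) : ℂ) • (memLp_hermiteFun (n + 1)).toLp :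
      Lp ℂ 2 (volume : Measure ℝ)) ((√n : ℂ) • (memLp_hermiteFun (n - 1)).toLp),
    Lp.coeFn_smul (√(n + 1) : ℂ) ((memLp_hermiteFun (n + 1)).toLp : Lp ℂ 2 (volume : Measure ℝ)),
    Lp.coeFn_smul (√n : ℂ) ((memLp_hermiteFun (n - 1)).toLp : Lp ℂ 2 (volume : Measure ℝ)),
    (memLp_hermiteFun (n + 1)).coeFn_toLp, (memLp_hermiteFun (n - 1)).coeFn_toLp]
    with x h1 h2 h3 h4 h5 h6
  rw [h1, Pi.smul_apply, h2, Pi.add_apply, h3, h4, Pi.smul_apply, Pi.smul_apply, h5, h6]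
  have h := hermiteFun_rec n x
  rw [Real.sqrt_div (by positivity), Real.sqrt_div (by positivity)] at h
  rw [← Complex.ofReal_mul, h]
  simp only [smul_eq_mul]
  push_cast
  ring

theorem positionRep_number_ae (b : HilbertBasis ℕ ℂ H) (n : ℕ) :
    positionRep b (b n) =ᵐ[volume] fun x => (hermiteFun n x : ℂ) := by
  rw [positionRep_number]
  exact (memLp_hermiteFun n).coeFn_toLp

/-- The graph of multiplication by `x` in the position representation. -/
def positionGraph (b : HilbertBasis ℕ ℂ H) : Submodule ℂ (H × H) where
  carrier := {p | positionRep b p.2 =ᵐ[volume] fun x => (x : ℂ) * positionRep b p.1 x}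
  add_mem' := by
    intro p q hp hq
    simp only [Set.mem_ofPred_eq, Prod.fst_add, Prod.snd_add, map_add] at hp hq ⊢
    filter_upwards [hp, hq, Lp.coeFn_add (positionRep b p.1) (positionRep b q.1),
      Lp.coeFn_add (positionRep b p.2) (positionRep b q.2)] with x h1 h2 h3 h4
    rw [h3, h4, Pi.add_apply, Pi.add_apply, h1, h2]; ring
  zero_mem' := by
    simp only [Set.mem_ofPred_eq, Prod.fst_zero, Prod.snd_zero, map_zero]
    filter_upwards [Lp.coeFn_zero ℂ 2 (volume : Measure ℝ)] with x hx
    simp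
  smul_mem' := by
    intro c p hp
    simp only [Set.mem_ofPred_eq, Prod.smul_fst, Prod.smul_snd, map_smul] at hp ⊢
    filter_upwards [hp, Lp.coeFn_smul c (positionRep b p.1), Lp.coeFn_smul c (positionRep b p.2)]
      with x h1 h3 h4
    rw [h3, h4, Pi.smul_apply, Pi.smul_apply, h1, smul_eq_mul, smul_eq_mul]; ring

theorem isClosed_positionGraph (b : HilbertBasis ℕ ℂ H) :
    IsClosed (positionGraph b : Set (H × H)) := by
  have hcont : Continuous fun p : H × H => (positionRep b p.1, positionRep b p.2) :=
    ((positionRep b).continuous.comp continuous_fst).prodMk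
      ((positionRep b).continuous.comp continuous_snd)
  exact isClosed_position_graph.preimage hcont

/-- The graph of `(a* + a)/√2` on the linear span of the number states, where
`(a* + a)|n⟩ = √(n+1) |n+1⟩ + √n |n-1⟩`. -/
def quadratureGraph (b : HilbertBasis ℕ ℂ H) : Submodule ℂ (H × H) :=
  Submodule.span ℂ (Set.range fun n : ℕ =>
    (b n, ((√2)⁻¹ : ℂ) • ((√(n + 1) : ℂ) • b (n + 1) + (√n : ℂ) • b (n - 1))))

theorem quadratureGraph_le (b : HilbertBasis ℕ ℂ H) : quadratureGraph b ≤ positionGraph b := by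
  rw [quadratureGraph, Submodule.span_le]
  rintro _ ⟨n, rfl⟩
  change positionRep b _ =ᵐ[volume] fun x => (x : ℂ) * positionRep b (b n) x
  filter_upwards [positionRep_quadrature b n, positionRep_number_ae b n] with x h1 h2
  rw [h1, h2]

/-- In the position representation the quadrature operator, i.e. the closure of
`(a* + a)/√2`, acts as multiplication by the variable `x`, with maximal domain. -/
theorem closure_quadratureGraph [CompleteSpace H] (b : HilbertBasis ℕ ℂ H) :
    (quadratureGraph b).topologicalClosure = positionGraph b := by
  refine le_antisymm (Submodule.topologicalClosure_minimal _ (quadratureGraph_le b)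
    (isClosed_positionGraph b)) ?_
  rintro ⟨φ, ψ⟩ h
  set S := quadratureGraph b with hS
  set W := positionRep b with hW
  by_contra hn
  obtain ⟨f, u, hf, hu⟩ := RCLike.geometric_hahn_banach_closed_point (𝕜 := ℂ)
    ((S.restrictScalars ℝ).convex.closure : Convex ℝ (closure (S : Set (H × H)))) isClosed_closure hn
  have hf0 : ∀ a ∈ S, f a = 0 := by
    intro a ha
    by_contra hfa
    have hpos : 0 < ‖f a‖ ^ 2 := by positivity
    have h1 := hf _ (subset_closure (S.smul_mem (((u / ‖f a‖ ^ 2 : ℝ) : ℂ) * star (f a)) ha))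
    rw [map_smul, smul_eq_mul, mul_assoc] at h1
    have h2 : star (f a) * f a = ((‖f a‖ ^ 2 : ℝ) : ℂ) := by
      rw [mul_comm]; exact_mod_cast Complex.mul_conj' (f a)
    rw [h2, ← Complex.ofReal_mul, div_mul_cancel₀ _ hpos.ne'] at h1
    simp at h1
  have hu0 : 0 < u := by
    have := hf 0 (subset_closure S.zero_mem)
    simpa using this
  obtain ⟨u', hu'⟩ := (InnerProductSpace.toDual ℂ H).surjective
    (f.comp (ContinuousLinearMap.inl ℂ H H))
  obtain ⟨v', hv'⟩ := (InnerProductSpace.toDual ℂ H).surjective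
    (f.comp (ContinuousLinearMap.inr ℂ H H))
  have hfe : ∀ p q : H, f (p, q) = ⟪W u', W p⟫_ℂ + ⟪W v', W q⟫_ℂ := by
    intro p q
    rw [W.inner_map_map, W.inner_map_map, ← InnerProductSpace.toDual_apply_apply, hu',
      ← InnerProductSpace.toDual_apply_apply, hv']
    simp [← map_add]
  have hint : ∀ (a a' : Lp ℂ 2 (volume : Measure ℝ)), Integrable fun x => ⟪a x, a' x⟫_ℂ :=
    fun a a' => L2.integrable_inner a a'
  have hfi : ∀ p q : H, W q =ᵐ[volume] (fun x => (x : ℂ) * W p x) →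
      f (p, q) = ∫ x, W p x * star (W u' x + x * W v' x) := by
    intro p q hpq
    rw [hfe, L2.inner_def, L2.inner_def, ← integral_add (hint _ _) (hint _ _)]
    apply integral_congr_ae
    filter_upwards [hpq] with x hx
    rw [hx]
    simp only [RCLike.inner_apply, star_add, star_mul', Complex.star_def, Complex.conj_ofReal]
    ring
  have hz := ae_zero_of_hermite (W u') (W v') (fun n => by
    have h1 := hf0 _ (Submodule.subset_span ⟨n, rfl⟩)
    rw [hfi _ _ (by
      filter_upwards [positionRep_quadrature b n, positionRep_number_ae b n] with x h1 h2
      rw [h1, h2])] at h1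
    have h2 := congrArg (starRingEnd ℂ) h1
    rw [← integral_conj, map_zero] at h2
    rw [← h2]
    apply integral_congr_ae
    filter_upwards [positionRep_number_ae b n] with x hx
    rw [← hW] at hx
    simp [hx])
  rw [hfi _ _ h] at hu
  have : ∫ x, W φ x * star (W u' x + x * W v' x) = 0 := by
    rw [integral_eq_zero_of_ae]
    filter_upwards [hz] with x hx
    have hx' : W u' x + x * W v' x = 0 := hx
    rw [hx']; simp
  rw [this] at hu
  simp at hu
  linarith

end

section
variable {ι : Type*} {H : Type*} [NormedAddCommGroup H] [InnerProductSpace ℂ H]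

theorem memℓp_mul_of_bounded {d : ι → ℂ} {C : ℝ} (hd : ∀ i, ‖d i‖ ≤ C)
    (c : lp (fun _ : ι => ℂ) 2) : Memℓp (fun i => d i * c i) 2 := by
  have hc := (memℓp_gen_iff (p := 2) (by norm_num)).1 (lp.memℓp c)
  refine memℓp_gen ((hc.mul_left (C ^ 2)).of_nonneg_of_le (fun i => by positivity) fun i => ?_)
  simp only [ENNReal.toReal_ofNat, Real.rpow_ofNat, norm_mul, mul_pow]
  gcongr
  exact hd i

/-- The bounded operator `∑ᵢ dᵢ |bᵢ⟩⟨bᵢ|`, which is diagonal with respect to the orthonormal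
basis `b`; the value is `0` if the sequence `d` is unbounded. -/
def diagOp (b : HilbertBasis ι ℂ H) (d : ι → ℂ) : H →L[ℂ] H :=
  open Classical in
  if h : ∃ C, ∀ i, ‖d i‖ ≤ C then
    (b.repr.symm : lp (fun _ : ι => ℂ) 2 →L[ℂ] H) ∘L
      (LinearMap.mkContinuous
        { toFun := fun c : lp (fun _ : ι => ℂ) 2 =>
            (⟨fun i => d i * c i, memℓp_mul_of_bounded h.choose_spec c⟩ :
              lp (fun _ : ι => ℂ) 2)
          map_add' := fun x y => by
            ext i
            change d i * (x i + y i) = d i * x i + d i * y i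
            ring
          map_smul' := fun a x => by
            ext i
            change d i * (a * x i) = a * (d i * x i)
            ring }
        |h.choose| (fun c => by
          have hC : ∀ i, ‖d i‖ ≤ |h.choose| := fun i => (h.choose_spec i).trans (le_abs_self _)
          have hs := (memℓp_gen_iff (p := 2) (by norm_num)).1 (lp.memℓp c)
          have hn := lp.norm_rpow_eq_tsum (p := 2) (by norm_num) c
          refine lp.norm_le_of_tsum_le (by norm_num) (by positivity) ?_
          simp only [ENNReal.toReal_ofNat, Real.rpow_ofNat] at hs hn ⊢
          rw [mul_pow, hn, ← tsum_mul_left]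
          have hb : ∀ i, ‖d i * c i‖ ^ 2 ≤ |h.choose| ^ 2 * ‖c i‖ ^ 2 := fun i => by
            rw [norm_mul, mul_pow]
            gcongr
            exact hC i
          exact Summable.tsum_le_tsum hb
            ((hs.mul_left _).of_nonneg_of_le (fun i => by positivity) hb) (hs.mul_left _))) ∘L
      (b.repr : H →L[ℂ] lp (fun _ : ι => ℂ) 2)
  else 0

theorem repr_diagOp (b : HilbertBasis ι ℂ H) {d : ι → ℂ} {C : ℝ} (h : ∀ i, ‖d i‖ ≤ C) (φ : H)
    (i : ι) : b.repr (diagOp b d φ) i = d i * b.repr φ i := by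
  rw [diagOp, dif_pos ⟨C, h⟩]
  simp

end

section
variable {H K : Type*} [NormedAddCommGroup H] [InnerProductSpace ℂ H]
  [NormedAddCommGroup K] [InnerProductSpace ℂ K]

theorem inner_rTensor_rTensor [CompleteSpace H] (A : H →L[ℂ] H) (x y : H ⊗[ℂ] K) :
    ⟪(A : H →ₗ[ℂ] H).rTensor K x, (A : H →ₗ[ℂ] H).rTensor K y⟫_ℂ =
      ⟪x, ((star A * A : H →L[ℂ] H) : H →ₗ[ℂ] H).rTensor K y⟫_ℂ := by
  induction x with
  | zero => simp
  | add x₁ x₂ h₁ h₂ => simp only [map_add, inner_add_left, h₁, h₂]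
  | tmul a c =>
    induction y with
    | zero => simp
    | add x₁ x₂ h₁ h₂ => simp only [map_add, inner_add_right, h₁, h₂]
    | tmul a' c' =>
      simp [ContinuousLinearMap.star_eq_adjoint, ContinuousLinearMap.adjoint_inner_right]

theorem norm_rTensor_le [CompleteSpace H] (A : H →L[ℂ] H) (x : H ⊗[ℂ] K) :
    ‖(A : H →ₗ[ℂ] H).rTensor K x‖ ≤ ‖A‖ * ‖x‖ := by
  have hpos : 0 ≤ ((‖A‖ ^ 2 : ℝ) : ℂ) • (1 : H →L[ℂ] H) - star A * A := by
    rw [ContinuousLinearMap.nonneg_iff_isPositive, ContinuousLinearMap.isPositive_def']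
    refine ⟨?_, fun v => ?_⟩
    · refine IsSelfAdjoint.sub ?_ (IsSelfAdjoint.star_mul_self A)
      rw [isSelfAdjoint_iff, star_smul, star_one]
      simp
    · rw [ContinuousLinearMap.reApplyInnerSelf_apply]
      simp only [sub_apply, smul_apply,
        one_apply_eq_self, inner_sub_left, inner_smul_left,
        mul_apply_eq_comp, ContinuousLinearMap.star_eq_adjoint,
        ContinuousLinearMap.adjoint_inner_left, map_sub]
      rw [inner_self_eq_norm_sq_to_K, inner_self_eq_norm_sq_to_K]
      have := A.le_opNorm v
      have h2 : ‖A v‖ ^ 2 ≤ ‖A‖ ^ 2 * ‖v‖ ^ 2 := by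
        rw [← mul_pow]; gcongr
      simp only [RCLike.mul_re, Complex.conj_ofReal]
      norm_cast
      simpa [← Complex.ofReal_pow] using h2
  obtain ⟨B, hB⟩ := CStarAlgebra.nonneg_iff_eq_star_mul_self.1 hpos
  have h1 := inner_rTensor_rTensor (K := K) B x x
  have h2 := inner_rTensor_rTensor (K := K) A x x
  have h3 : ((star B * B : H →L[ℂ] H) : H →ₗ[ℂ] H).rTensor K x =
      ((‖A‖ ^ 2 : ℝ) : ℂ) • x - ((star A * A : H →L[ℂ] H) : H →ₗ[ℂ] H).rTensor K x := by
    rw [← hB, ContinuousLinearMap.toLinearMap_sub, ContinuousLinearMap.toLinearMap_smul,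
      LinearMap.rTensor_sub, LinearMap.rTensor_smul]
    rw [ContinuousLinearMap.toLinearMap_one, Module.End.one_eq_id, LinearMap.rTensor_id]
    rfl
  have h5 : ⟪x, ((‖A‖ ^ 2 : ℝ) : ℂ) • x⟫_ℂ = ((‖A‖ ^ 2 : ℝ) : ℂ) * ⟪x, x⟫_ℂ :=
    inner_smul_right (𝕜 := ℂ) (E := H ⊗[ℂ] K) x x _
  have h6 : ∀ y : H ⊗[ℂ] K, ⟪y, y⟫_ℂ = ((‖y‖ ^ 2 : ℝ) : ℂ) := fun y => by
    have := inner_self_eq_norm_sq_to_K (𝕜 := ℂ) (E := H ⊗[ℂ] K) y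
    exact_mod_cast this
  rw [h3, inner_sub_right, ← h2, h5, h6, h6, h6] at h1
  have h4 : ‖(B : H →ₗ[ℂ] H).rTensor K x‖ ^ 2 =
      ‖A‖ ^ 2 * ‖x‖ ^ 2 - ‖(A : H →ₗ[ℂ] H).rTensor K x‖ ^ 2 := by exact_mod_cast h1
  refine (sq_le_sq₀ (norm_nonneg _) (by positivity)).1 ?_
  nlinarith [sq_nonneg ‖(B : H →ₗ[ℂ] H).rTensor K x‖]

theorem norm_tensor_map_le [CompleteSpace H] [CompleteSpace K] (A : H →L[ℂ] H) (B : K →L[ℂ] K)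
    (x : H ⊗[ℂ] K) :
    ‖TensorProduct.map (A : H →ₗ[ℂ] H) (B : K →ₗ[ℂ] K) x‖ ≤ ‖A‖ * ‖B‖ * ‖x‖ := by
  have h : TensorProduct.map (A : H →ₗ[ℂ] H) (B : K →ₗ[ℂ] K) x =
      (A : H →ₗ[ℂ] H).rTensor K (TensorProduct.comm ℂ K H
        ((B : K →ₗ[ℂ] K).rTensor H (TensorProduct.comm ℂ H K x))) := by
    induction x with
    | zero => simp
    | add x₁ x₂ h₁ h₂ => simp only [map_add, h₁, h₂]
    | tmul a c => simp
  rw [h, mul_assoc]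
  refine (norm_rTensor_le A _).trans ?_
  gcongr
  rw [TensorProduct.norm_comm]
  refine (norm_rTensor_le B _).trans ?_
  rw [TensorProduct.norm_comm]

/-- The Hilbert space tensor product: the completion of the algebraic tensor product. -/
abbrev HilbertTensor (H K : Type*) [NormedAddCommGroup H] [InnerProductSpace ℂ H]
    [NormedAddCommGroup K] [InnerProductSpace ℂ K] : Type _ :=
  UniformSpace.Completion (H ⊗[ℂ] K)

/-- The product vector `φ ⊗ ψ`. -/
def tensorVec (φ : H) (ψ : K) : HilbertTensor H K := ((φ ⊗ₜ[ℂ] ψ : H ⊗[ℂ] K) : HilbertTensor H K)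

/-- The tensor product `A ⊗ B` of two bounded operators. -/
def tensorOp [CompleteSpace H] [CompleteSpace K] (A : H →L[ℂ] H) (B : K →L[ℂ] K) :
    HilbertTensor H K →L[ℂ] HilbertTensor H K :=
  ((TensorProduct.map (A : H →ₗ[ℂ] H) (B : K →ₗ[ℂ] K)).mkContinuous (‖A‖ * ‖B‖)
    (norm_tensor_map_le A B)).completion

theorem tensorOp_tensorVec [CompleteSpace H] [CompleteSpace K] (A : H →L[ℂ] H) (B : K →L[ℂ] K)
    (φ : H) (ψ : K) : tensorOp A B (tensorVec φ ψ) = tensorVec (A φ) (B ψ) := by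
  simp [tensorOp, tensorVec]

theorem inner_tensorVec (φ φ' : H) (ψ ψ' : K) :
    ⟪tensorVec φ ψ, tensorVec φ' ψ'⟫_ℂ = ⟪φ, φ'⟫_ℂ * ⟪ψ, ψ'⟫_ℂ := by
  simp [tensorVec]

/-- The isometry `φ ↦ φ ⊗ ψ` (for a unit vector `ψ`). -/
def tensorRight (H : Type*) [NormedAddCommGroup H] [InnerProductSpace ℂ H] (ψ : K) :
    H →L[ℂ] HilbertTensor H K :=
  UniformSpace.Completion.toComplL ∘L (TensorProduct.mkL ℂ H K).flip ψ

theorem tensorRight_apply (φ : H) (ψ : K) : tensorRight H ψ φ = tensorVec φ ψ := rfl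

end

section
variable {H K : Type*} [NormedAddCommGroup H] [InnerProductSpace ℂ H]
  [NormedAddCommGroup K] [InnerProductSpace ℂ K]

/-- The coherent state `|z⟩ = exp(-|z|²/2) ∑ₙ zⁿ/√(n!) |n⟩`. -/
def coherent (b : HilbertBasis ℕ ℂ H) (z : ℂ) : H :=
  (Real.exp (-‖z‖ ^ 2 / 2) : ℂ) • ∑' n : ℕ, (z ^ n / (√(n.factorial : ℝ) : ℂ)) • b n

theorem memℓp_coherent (z : ℂ) :
    Memℓp (fun n : ℕ => z ^ n / (√(n.factorial : ℝ) : ℂ)) 2 := by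
  refine memℓp_gen ((Real.summable_pow_div_factorial (‖z‖ ^ 2)).congr fun n => ?_)
  simp only [ENNReal.toReal_ofNat, Real.rpow_ofNat, norm_div, norm_pow, Complex.norm_real,
    Real.norm_eq_abs, div_pow, sq_abs]
  rw [Real.sq_sqrt (by positivity)]
  ring

theorem repr_coherent (b : HilbertBasis ℕ ℂ H) (z : ℂ) (n : ℕ) :
    b.repr (coherent b z) n =
      (Real.exp (-‖z‖ ^ 2 / 2) : ℂ) * (z ^ n / (√(n.factorial : ℝ) : ℂ)) := by
  have h := (b.hasSum_repr_symm ⟨_, memℓp_coherent z⟩).tsum_eq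
  rw [coherent]
  change b.repr ((Real.exp (-‖z‖ ^ 2 / 2) : ℂ) •
    ∑' n : ℕ, (⟨_, memℓp_coherent z⟩ : lp (fun _ : ℕ => ℂ) 2) n • b n) n = _
  rw [h, map_smul, LinearIsometryEquiv.apply_symm_apply]
  rfl

theorem inner_coherent (b : HilbertBasis ℕ ℂ H) (α β : ℂ) :
    ⟪coherent b α, coherent b β⟫_ℂ =
      Complex.exp (-(‖α‖ ^ 2 / 2 : ℝ) - (‖β‖ ^ 2 / 2 : ℝ) + (starRingEnd ℂ) α * β) := by
  rw [← b.repr.inner_map_map, lp.inner_eq_tsum]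
  simp only [repr_coherent, RCLike.inner_apply, map_mul, map_div₀, map_pow, Complex.conj_ofReal]
  have hs := NormedSpace.expSeries_div_hasSum_exp (𝔸 := ℂ) ((starRingEnd ℂ) α * β)
  rw [← Complex.exp_eq_exp_ℂ] at hs
  rw [Complex.exp_add, ← hs.tsum_eq, ← tsum_mul_left]
  congr 1
  ext n
  have h1 : (√(n.factorial : ℝ) : ℂ) * (√(n.factorial : ℝ) : ℂ) = n.factorial := by
    rw [← Complex.ofReal_mul, Real.mul_self_sqrt (by positivity)]; simp
  have h2 : Complex.exp (-(‖α‖ ^ 2 / 2 : ℝ) - (‖β‖ ^ 2 / 2 : ℝ)) =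
      (Real.exp (-‖β‖ ^ 2 / 2) : ℂ) * (Real.exp (-‖α‖ ^ 2 / 2) : ℂ) := by
    rw [← Complex.ofReal_mul, ← Real.exp_add]; push_cast; congr 1; ring
  rw [h2, mul_pow, ← h1]
  have h3 : (√(n.factorial : ℝ) : ℂ) ≠ 0 := by
    exact_mod_cast (Real.sqrt_pos.2 (by positivity : (0:ℝ) < n.factorial)).ne'
  field_simp

theorem norm_coherent (b : HilbertBasis ℕ ℂ H) (z : ℂ) : ‖coherent b z‖ = 1 := by
  have h := inner_coherent b z z
  rw [inner_self_eq_norm_sq_to_K, mul_comm, Complex.mul_conj'] at h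
  have : (-(‖z‖ ^ 2 / 2 : ℝ) - (‖z‖ ^ 2 / 2 : ℝ) + (‖z‖ : ℂ) ^ 2 : ℂ) = 0 := by push_cast; ring
  rw [this, Complex.exp_zero] at h
  have h2 : ‖coherent b z‖ ^ 2 = 1 := by
    rw [← Complex.ofReal_one, ← RCLike.ofReal_pow] at h
    exact Complex.ofReal_injective h
  exact (pow_eq_one_iff_of_nonneg (norm_nonneg _) two_ne_zero).1 h2

theorem eq_zero_of_inner_coherent (b : HilbertBasis ℕ ℂ H) (w : H)
    (h : ∀ z, ⟪w, coherent b z⟫_ℂ = 0) : w = 0 := by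
  set p : FormalMultilinearSeries ℂ ℂ ℂ := FormalMultilinearSeries.ofScalars ℂ
    (fun n : ℕ => (starRingEnd ℂ) (b.repr w n) / (√(n.factorial : ℝ) : ℂ)) with hp
  have hpn : ∀ (n : ℕ) (z : ℂ), (p n fun _ => z) =
      z ^ n * ((starRingEnd ℂ) (b.repr w n) / (√(n.factorial : ℝ) : ℂ)) := by
    intro n z
    rw [hp, FormalMultilinearSeries.ofScalars_apply_eq, smul_eq_mul, mul_comm]
  have hsum : ∀ z : ℂ, HasSum (fun n : ℕ => p n fun _ => z) 0 := by
    intro z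
    have h1 := lp.hasSum_inner (𝕜 := ℂ) (b.repr w) (b.repr (coherent b z))
    rw [b.repr.inner_map_map, h z] at h1
    have h2 := h1.mul_left ((Real.exp (-‖z‖ ^ 2 / 2) : ℂ)⁻¹)
    rw [mul_zero] at h2
    have h3 : (Real.exp (-‖z‖ ^ 2 / 2) : ℂ) ≠ 0 := by exact_mod_cast (Real.exp_pos _).ne'
    have e : (fun n : ℕ => p n fun _ => z) = fun n => (Real.exp (-‖z‖ ^ 2 / 2) : ℂ)⁻¹ *
        ⟪b.repr w n, b.repr (coherent b z) n⟫_ℂ := by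
      funext n
      rw [hpn, repr_coherent, RCLike.inner_apply]
      field_simp
    rw [e]
    exact h2
  have hball : HasFPowerSeriesOnBall (fun _ : ℂ => (0 : ℂ)) p 0 1 :=
    { r_le := by
        have := p.le_radius_of_bound (r := 1) ‖w‖ (fun n => by
          rw [hp, FormalMultilinearSeries.ofScalars_norm, norm_div, RCLike.norm_conj]
          have h1 : ‖b.repr w n‖ ≤ ‖w‖ := by
            rw [← b.repr.norm_map w]
            exact lp.norm_apply_le_norm (by norm_num) _ _
          have h2 : 1 ≤ ‖(√(n.factorial : ℝ) : ℂ)‖ := by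
            rw [Complex.norm_real, Real.norm_eq_abs, abs_of_nonneg (Real.sqrt_nonneg _),
              Real.one_le_sqrt]
            exact_mod_cast Nat.one_le_iff_ne_zero.2 n.factorial_ne_zero
          simp only [NNReal.coe_one, one_pow, mul_one]
          exact (div_le_self (norm_nonneg _) h2).trans h1)
        simpa using this
      r_pos := one_pos
      hasSum := fun {y} _ => hsum y }
  have hp0 : p = 0 := hball.hasFPowerSeriesAt.eq_zero
  apply b.repr.injective
  rw [map_zero]
  ext n
  have h1 := hpn n 1
  rw [hp0, one_pow, one_mul] at h1
  have h2 : (√(n.factorial : ℝ) : ℂ) ≠ 0 := by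
    exact_mod_cast (Real.sqrt_pos.2 (by positivity : (0:ℝ) < n.factorial)).ne'
  have h3 : (starRingEnd ℂ) (b.repr w n) = 0 := by
    have h4 := (div_eq_zero_iff.1 h1.symm).resolve_right h2
    exact h4
  simpa using h3

theorem eq_zero_of_inner_coherent_tensor [CompleteSpace H] [CompleteSpace K] 
    (b : HilbertBasis ℕ ℂ H) (c : HilbertBasis ℕ ℂ K)
    (w : HilbertTensor H K) (h : ∀ α β, ⟪w, tensorVec (coherent b α) (coherent c β)⟫_ℂ = 0) :
    w = 0 := by
  -- first vary the left factor, then the right factor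
  have h1 : ∀ (φ : H) (β : ℂ), ⟪w, tensorVec φ (coherent c β)⟫_ℂ = 0 := by
    intro φ β
    set T := tensorRight H (coherent c β)
    have : T.adjoint w = 0 := eq_zero_of_inner_coherent b _ fun α => by
      rw [ContinuousLinearMap.adjoint_inner_left]; exact h α β
    rw [← tensorRight_apply, ← ContinuousLinearMap.adjoint_inner_left, this, inner_zero_left]
  have h2 : ∀ (φ : H) (ψ : K), ⟪w, tensorVec φ ψ⟫_ℂ = 0 := by
    intro φ ψ
    set T : K →L[ℂ] HilbertTensor H K :=
      UniformSpace.Completion.toComplL ∘L (TensorProduct.mkL ℂ H K) φ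
    have hT : ∀ ψ, T ψ = tensorVec φ ψ := fun _ => rfl
    have : T.adjoint w = 0 := eq_zero_of_inner_coherent c _ fun β => by
      rw [ContinuousLinearMap.adjoint_inner_left, hT]; exact h1 φ β
    rw [← hT, ← ContinuousLinearMap.adjoint_inner_left, this, inner_zero_left]
  have h3 : ∀ x : H ⊗[ℂ] K, ⟪w, (x : HilbertTensor H K)⟫_ℂ = 0 := by
    intro x
    induction x with
    | zero => rw [UniformSpace.Completion.coe_zero, inner_zero_right]
    | add x y hx hy => rw [UniformSpace.Completion.coe_add, inner_add_right, hx, hy, add_zero]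
    | tmul φ ψ => exact h2 φ ψ
  have h4 : ∀ y : HilbertTensor H K, ⟪w, y⟫_ℂ = 0 := fun y =>
    UniformSpace.Completion.induction_on y
      (isClosed_eq (by fun_prop) continuous_const) h3
  exact inner_self_eq_zero.1 (h4 w)

/-- The linear map on finite formal combinations of pairs `(α, β)` with
`(α, β) ↦ |α⟩ ⊗ |β⟩`. -/
def coherentPairs (b : HilbertBasis ℕ ℂ H) (c : HilbertBasis ℕ ℂ K) :
    (ℂ × ℂ →₀ ℂ) →ₗ[ℂ] HilbertTensor H K :=
  Finsupp.linearCombination ℂ fun p => tensorVec (coherent b p.1) (coherent c p.2)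

/-- The linear map on finite formal combinations of pairs `(α, β)` with
`(α, β) ↦ |(α - β)/√2⟩ ⊗ |(α + β)/√2⟩`. -/
def splitPairs (b : HilbertBasis ℕ ℂ H) (c : HilbertBasis ℕ ℂ K) :
    (ℂ × ℂ →₀ ℂ) →ₗ[ℂ] HilbertTensor H K :=
  Finsupp.linearCombination ℂ fun p =>
    tensorVec (coherent b ((p.1 - p.2) / √2)) (coherent c ((p.1 + p.2) / √2))

/-- The lossless 50:50 beam splitter: the continuous linear extension of
`|α⟩ ⊗ |β⟩ ↦ |(α - β)/√2⟩ ⊗ |(α + β)/√2⟩` from the dense span of the products of coherent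
states. -/
def beamSplitter (b : HilbertBasis ℕ ℂ H) (c : HilbertBasis ℕ ℂ K) :
    HilbertTensor H K →L[ℂ] HilbertTensor H K :=
  (splitPairs b c).extendOfNorm (coherentPairs b c)

theorem norm_splitPairs (b : HilbertBasis ℕ ℂ H) (c : HilbertBasis ℕ ℂ K) (x : ℂ × ℂ →₀ ℂ) :
    ‖splitPairs b c x‖ = ‖coherentPairs b c x‖ := by
  have key : ⟪splitPairs b c x, splitPairs b c x⟫_ℂ =
      ⟪coherentPairs b c x, coherentPairs b c x⟫_ℂ := by
    simp only [splitPairs, coherentPairs, Finsupp.linearCombination_apply, Finsupp.sum,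
      sum_inner, inner_sum, inner_smul_left, inner_smul_right, inner_tensorVec, inner_coherent,
      ← Complex.exp_add]
    refine Finset.sum_congr rfl fun p _ => ?_
    congr 1
    refine Finset.sum_congr rfl fun q _ => ?_
    congr 2
    have h2 : (√2 : ℂ) * (√2 : ℂ) = 2 := by
      rw [← Complex.ofReal_mul, Real.mul_self_sqrt (by norm_num)]; simp
    have h2' : (√2 : ℂ) ≠ 0 := fun h => by simp [h] at h2
    have hn : ∀ z : ℂ, ((‖z‖ ^ 2 / 2 : ℝ) : ℂ) = z * (starRingEnd ℂ) z / 2 := by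
      intro z; rw [Complex.mul_conj']; push_cast; rfl
    simp only [hn, map_div₀, map_sub, map_add, Complex.conj_ofReal]
    have hd : ∀ u v : ℂ, u / √2 * (v / √2) = u * v / 2 := by
      intro u v; rw [div_mul_div_comm, h2]
    simp only [hd]
    ring
  rw [inner_self_eq_norm_sq_to_K, inner_self_eq_norm_sq_to_K] at key
  rw [← RCLike.ofReal_pow, ← RCLike.ofReal_pow] at key
  have := Complex.ofReal_injective key
  exact (sq_eq_sq₀ (norm_nonneg _) (norm_nonneg _)).1 this

theorem denseRange_coherentPairs [CompleteSpace H] [CompleteSpace K]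
    (b : HilbertBasis ℕ ℂ H) (c : HilbertBasis ℕ ℂ K) : DenseRange (coherentPairs b c) := by
  have : (LinearMap.range (coherentPairs b c)).topologicalClosure = ⊤ := by
    rw [Submodule.topologicalClosure_eq_top_iff, Submodule.eq_bot_iff]
    intro w hw
    refine eq_zero_of_inner_coherent_tensor b c w fun α β => ?_
    refine (Submodule.mem_orthogonal' _ _).1 hw _ ⟨Finsupp.single (α, β) 1, ?_⟩
    simp [coherentPairs]
  have h2 := Submodule.dense_iff_topologicalClosure_eq_top.2 this
  rw [LinearMap.coe_range] at h2
  exact h2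

theorem beamSplitter_coherent [CompleteSpace H] [CompleteSpace K]
    (b : HilbertBasis ℕ ℂ H) (c : HilbertBasis ℕ ℂ K) (α β : ℂ) :
    beamSplitter b c (tensorVec (coherent b α) (coherent c β)) =
      tensorVec (coherent b ((α - β) / √2)) (coherent c ((α + β) / √2)) := by
  have h := LinearMap.extendOfNorm_eq (f := splitPairs b c) (denseRange_coherentPairs b c)
    ⟨1, fun x => by rw [one_mul]; exact (norm_splitPairs b c x).le⟩ (Finsupp.single (α, β) 1)
  simpa [coherentPairs, splitPairs, beamSplitter] using h

theorem norm_beamSplitter_apply [CompleteSpace H] [CompleteSpace K]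
    (b : HilbertBasis ℕ ℂ H) (c : HilbertBasis ℕ ℂ K) (w : HilbertTensor H K) :
    ‖beamSplitter b c w‖ = ‖w‖ := by
  refine (denseRange_coherentPairs b c).induction_on (p := fun w => ‖beamSplitter b c w‖ = ‖w‖) w
    (isClosed_eq (by fun_prop) (by fun_prop)) fun x => ?_
  rw [beamSplitter, LinearMap.extendOfNorm_eq (f := splitPairs b c) (denseRange_coherentPairs b c)
    ⟨1, fun x => by rw [one_mul]; exact (norm_splitPairs b c x).le⟩, norm_splitPairs]

theorem beamSplitter_mem_unitary [CompleteSpace H] [CompleteSpace K]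
    (b : HilbertBasis ℕ ℂ H) (c : HilbertBasis ℕ ℂ K) :
    beamSplitter b c ∈ unitary (HilbertTensor H K →L[ℂ] HilbertTensor H K) := by
  have h1 : star (beamSplitter b c) * beamSplitter b c = 1 :=
    (ContinuousLinearMap.norm_map_iff_adjoint_comp_self _).1 (norm_beamSplitter_apply b c)
  refine ⟨h1, ?_⟩
  -- the adjoint is injective, as the range contains all products of coherent states
  have hinj : ∀ w, star (beamSplitter b c) w = 0 → w = 0 := by
    intro w hw
    refine eq_zero_of_inner_coherent_tensor b c w fun α β => ?_
    have h2' : (√2 : ℂ) ≠ 0 := by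
      exact_mod_cast (Real.sqrt_pos.2 (by norm_num : (0:ℝ) < 2)).ne'
    have h2 : (√2 : ℂ) * (√2 : ℂ) = 2 := by
      rw [← Complex.ofReal_mul, Real.mul_self_sqrt (by norm_num)]; simp
    have hb := beamSplitter_coherent b c ((α + β) / √2) ((β - α) / √2)
    have e1 : ((α + β) / √2 - (β - α) / √2) / (√2 : ℂ) = α := by
      rw [← sub_div, div_div, h2]; ring
    have e2 : ((α + β) / √2 + (β - α) / √2) / (√2 : ℂ) = β := by
      rw [← add_div, div_div, h2]; ring
    rw [e1, e2] at hb
    rw [← hb, ← ContinuousLinearMap.adjoint_inner_left]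
    rw [ContinuousLinearMap.star_eq_adjoint] at hw
    rw [hw, inner_zero_left]
  ext w
  have : star (beamSplitter b c) ((beamSplitter b c * star (beamSplitter b c)) w - w) = 0 := by
    rw [map_sub]
    have := congrArg (fun A : HilbertTensor H K →L[ℂ] HilbertTensor H K =>
      A (star (beamSplitter b c) w)) h1
    simpa [sub_eq_zero] using this
  simpa [sub_eq_zero] using hinj _ this

end

section
variable {H K : Type*} [NormedAddCommGroup H] [InnerProductSpace ℂ H]
  [NormedAddCommGroup K] [InnerProductSpace ℂ K]

/-- An observable on the real line: a normalized positive operator measure, σ-additive in the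
weak operator topology. Only the values on Borel sets are constrained. -/
structure IsObservable [CompleteSpace H] (E : Set ℝ → H →L[ℂ] H) : Prop where
  isPositive : ∀ X, MeasurableSet X → (E X).IsPositive
  univ : E Set.univ = 1
  hasSum_iUnion : ∀ X : ℕ → Set ℝ, (∀ i, MeasurableSet (X i)) → Pairwise (Function.onFun Disjoint X) →
    HasSum (fun i => (ContinuousLinearMapWOT.ofCLM (E (X i)) : H →WOT[ℂ] H))
      (ContinuousLinearMapWOT.ofCLM (E (⋃ i, X i)))

/-- Convergence of observables weakly in the sense of probabilities: `E k X → F X` in the weak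
operator topology for all Borel sets `X` whose boundary is a null set of `F`. -/
structure ConvergesWeaklyInProbabilities [CompleteSpace H] (E : ℕ → Set ℝ → H →L[ℂ] H)
    (F : Set ℝ → H →L[ℂ] H) : Prop where
  isObservable : ∀ k, IsObservable (E k)
  isObservable_limit : IsObservable F
  tendsto : ∀ X, MeasurableSet X → F (frontier X) = 0 →
    Tendsto (fun k => (ContinuousLinearMapWOT.ofCLM (E k X) : H →WOT[ℂ] H)) atTop
      (𝓝 (ContinuousLinearMapWOT.ofCLM (F X)))

/-- `A` is the weak integral `∫ f(x) dE(x)`: for every vector `φ`, with `ν` the finite measure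
`X ↦ ⟪φ, E X φ⟫`, one has `⟪φ, A φ⟫ = ∫ f dν`. (By polarization this determines `A`.) -/
def IsWeakIntegral (E : Set ℝ → H →L[ℂ] H) (f : ℝ → ℝ) (A : H →L[ℂ] H) : Prop :=
  ∀ φ : H, ∃ ν : Measure ℝ, IsFiniteMeasure ν ∧
    (∀ X, MeasurableSet X → ((ν.real X : ℝ) : ℂ) = ⟪φ, E X φ⟫_ℂ) ∧
    ⟪φ, A φ⟫_ℂ = ((∫ x, f x ∂ν : ℝ) : ℂ)

theorem IsWeakIntegral.unique {E : Set ℝ → H →L[ℂ] H} {f : ℝ → ℝ} {A B : H →L[ℂ] H}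
    (hA : IsWeakIntegral E f A) (hB : IsWeakIntegral E f B) : A = B := by
  have h : ∀ φ, ⟪A φ, φ⟫_ℂ = ⟪B φ, φ⟫_ℂ := by
    intro φ
    obtain ⟨ν, h1, h2, h3⟩ := hA φ
    obtain ⟨ν', h1', h2', h3'⟩ := hB φ
    have : ν = ν' := Measure.ext fun X hX => by
      have := (h2 X hX).trans (h2' X hX).symm
      exact (measureReal_eq_measureReal_iff).1 (Complex.ofReal_injective this)
    have h4 : ⟪φ, A φ⟫_ℂ = ⟪φ, B φ⟫_ℂ := by rw [h3, h3', this]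
    rw [← inner_conj_symm, h4, inner_conj_symm]
  have := (ext_inner_map (A : H →ₗ[ℂ] H) (B : H →ₗ[ℂ] H)).1 h
  exact ContinuousLinearMap.coe_injective this

/-- The weak integral `∫ f(x) dE(x)` (with value `0` if it does not exist). -/
def weakIntegral (E : Set ℝ → H →L[ℂ] H) (f : ℝ → ℝ) : H →L[ℂ] H :=
  open Classical in if h : ∃ A, IsWeakIntegral E f A then h.choose else 0

/-- The smearing `(μ * E)(X) = ∫ μ(X - x) dE(x)` of `E` by a probability measure `μ`. -/
def smear (μ : Measure ℝ) (E : Set ℝ → H →L[ℂ] H) (X : Set ℝ) : H →L[ℂ] H :=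
  weakIntegral E fun x => μ.real {y | y + x ∈ X}

/-- The quadrature observable `Q`: in the position representation, `Q X` is multiplication by
the indicator function of `X`. Since the closure of `(a* + a)/√2` is multiplication by `x`
(see `closure_quadratureGraph`), this is its spectral measure. -/
def quadrature (b : HilbertBasis ℕ ℂ H) (X : Set ℝ) : H →L[ℂ] H :=
  ((positionRep b).symm : Lp ℂ 2 (volume : Measure ℝ) →L[ℂ] H) ∘L
    mulOp (X.indicator fun _ => 1) ∘L (positionRep b : H →L[ℂ] Lp ℂ 2 (volume : Measure ℝ))

/-- The unitary operator `exp(iθN)`, where `N` is the number operator. -/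
def phaseShift (b : HilbertBasis ℕ ℂ H) (θ : ℝ) : H →L[ℂ] H :=
  diagOp b fun n => Complex.exp (Complex.I * θ * n)

/-- The rotated quadrature observable `Q_θ(X) = exp(iθN) Q(X) exp(-iθN)`. -/
def rotatedQuadrature (b : HilbertBasis ℕ ℂ H) (θ : ℝ) (X : Set ℝ) : H →L[ℂ] H :=
  phaseShift b θ ∘L quadrature b X ∘L phaseShift b (-θ)

/-- The detection observable of a photon detector with efficiency `ε`: the effect
`∑_{m ≥ n} (m choose n) εⁿ (1 - ε)^(m - n) |m⟩⟨m|` of detecting `n` photons. (The coefficients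
with `m < n` vanish because the binomial coefficient does.) -/
def detectorEffect (b : HilbertBasis ℕ ℂ H) (ε : ℝ) (n : ℕ) : H →L[ℂ] H :=
  diagOp b fun m => ((m.choose n * ε ^ n * (1 - ε) ^ (m - n) : ℝ) : ℂ)

/-- The observable of scaled photon number differences: the sum (in the weak operator topology)
of `E^{ε₁}_m ⊗ E^{ε₂}_n` over all `(m, n)` with `(n/ε₂ - m/ε₁)/(√2 |z|) ∈ X`. -/
def differenceObservable [CompleteSpace H] [CompleteSpace K] (b : HilbertBasis ℕ ℂ H)
    (c : HilbertBasis ℕ ℂ K) (ε₁ ε₂ : ℝ) (z : ℂ) (X : Set ℝ) :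
    HilbertTensor H K →L[ℂ] HilbertTensor H K :=
  (∑' p : {p : ℕ × ℕ // 1 / (√2 * ‖z‖) * (p.2 / ε₂ - p.1 / ε₁) ∈ X},
    (ContinuousLinearMapWOT.ofCLM
        (tensorOp (detectorEffect b ε₁ p.1.1) (detectorEffect c ε₂ p.1.2)) :
      HilbertTensor H K →WOT[ℂ] HilbertTensor H K)).toCLM

/-- The signal observable `E^z(X) = V_z* U* E(X) U V_z` measured by the inefficient balanced
homodyne detector whose local oscillator is in the coherent state `|z⟩`; here
`V_z φ = φ ⊗ |z⟩` and `U` is the beam splitter. -/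
def signalObservable [CompleteSpace H] [CompleteSpace K] (b : HilbertBasis ℕ ℂ H)
    (c : HilbertBasis ℕ ℂ K) (ε₁ ε₂ : ℝ) (z : ℂ) (X : Set ℝ) : H →L[ℂ] H :=
  (tensorRight H (coherent c z)).adjoint ∘L (beamSplitter b c).adjoint ∘L
    differenceObservable b c ε₁ ε₂ z X ∘L beamSplitter b c ∘L tensorRight H (coherent c z)

/-- The Gaussian probability density `f_{ε₁,ε₂}`. -/
def smearingDensity (ε₁ ε₂ x : ℝ) : ℝ :=
  √(2 * ε₁ * ε₂ / (Real.pi * (ε₁ - 2 * ε₁ * ε₂ + ε₂))) *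
    Real.exp (-(2 * ε₁ * ε₂ / (ε₁ - 2 * ε₁ * ε₂ + ε₂)) * x ^ 2)

/-- The probability measure `μ_{ε₁,ε₂}`: it has the density `f_{ε₁,ε₂}`, except that `μ_{1,1}` is
the Dirac measure at the origin. -/
def smearingMeasure (ε₁ ε₂ : ℝ) : Measure ℝ :=
  open Classical in
  if ε₁ = 1 ∧ ε₂ = 1 then Measure.dirac 0
  else volume.withDensity fun x => ENNReal.ofReal (smearingDensity ε₁ ε₂ x)

end

section
variable {H : Type*} [NormedAddCommGroup H] [InnerProductSpace ℂ H]

theorem inner_phaseShift (b : HilbertBasis ℕ ℂ H) (θ : ℝ) (φ ψ : H) :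
    ⟪φ, phaseShift b θ ψ⟫_ℂ = ⟪phaseShift b (-θ) φ, ψ⟫_ℂ := by
  have hb : ∀ (t : ℝ) (n : ℕ), ‖Complex.exp (Complex.I * t * n)‖ ≤ 1 := fun t n => by
    rw [show Complex.I * t * n = ((t * n : ℝ) : ℂ) * Complex.I by push_cast; ring,
      Complex.norm_exp_ofReal_mul_I]
  rw [← b.repr.inner_map_map, ← b.repr.inner_map_map (phaseShift b (-θ) φ), lp.inner_eq_tsum,
    lp.inner_eq_tsum]
  congr 1
  ext n
  rw [phaseShift, phaseShift, repr_diagOp b (hb θ), repr_diagOp b (hb (-θ))]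
  simp only [RCLike.inner_apply, map_mul, ← Complex.exp_conj, Complex.conj_I, Complex.conj_ofReal,
    Complex.conj_natCast]
  push_cast
  ring_nf

/-- The weak integral of a bounded measurable function with respect to `Q_θ` exists. -/
theorem isWeakIntegral_rotatedQuadrature (b : HilbertBasis ℕ ℂ H) (θ : ℝ) {f : ℝ → ℝ}
    (hf : Measurable f) {C : ℝ} (hC : ∀ x, |f x| ≤ C) :
    IsWeakIntegral (rotatedQuadrature b θ) f
      (phaseShift b θ ∘L ((positionRep b).symm : Lp ℂ 2 (volume : Measure ℝ) →L[ℂ] H) ∘L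
        mulOp (fun x => (f x : ℂ)) ∘L
        (positionRep b : H →L[ℂ] Lp ℂ 2 (volume : Measure ℝ)) ∘L phaseShift b (-θ)) := by
  intro φ
  set W := positionRep b with hW
  set g := W (phaseShift b (-θ) φ) with hg
  have hnn : ∀ x, ((‖g x‖₊ ^ 2 : NNReal) : ℝ≥0∞) = ENNReal.ofReal (‖g x‖ ^ 2) := fun x => by
    rw [ENNReal.ofReal_pow (norm_nonneg _), ofReal_norm, enorm_eq_nnnorm]
    simp
  have hgm : AEMeasurable (fun x => ‖g x‖₊ ^ 2) volume :=
    (Lp.aestronglyMeasurable g).aemeasurable.nnnorm.pow_const 2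
  have hgi : Integrable fun x => ‖g x‖ ^ 2 :=
    (memLp_two_iff_integrable_sq_norm (Lp.aestronglyMeasurable g)).1 (Lp.memLp g)
  have hin : ∀ {h : ℝ → ℂ}, MemLp h ∞ volume → ⟪φ, (phaseShift b θ ∘L
      (W.symm : Lp ℂ 2 (volume : Measure ℝ) →L[ℂ] H) ∘L mulOp h ∘L
      (W : H →L[ℂ] Lp ℂ 2 (volume : Measure ℝ)) ∘L phaseShift b (-θ)) φ⟫_ℂ =
      ∫ x, h x * ((‖g x‖ ^ 2 : ℝ) : ℂ) := by
    intro h hh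
    have e : (phaseShift b θ ∘L
      (W.symm : Lp ℂ 2 (volume : Measure ℝ) →L[ℂ] H) ∘L mulOp h ∘L
      (W : H →L[ℂ] Lp ℂ 2 (volume : Measure ℝ)) ∘L phaseShift b (-θ)) φ =
        phaseShift b θ (W.symm (mulOp h g)) := rfl
    rw [e, inner_phaseShift, ← W.inner_map_map, W.apply_symm_apply, ← hg, L2.inner_def]
    apply integral_congr_ae
    filter_upwards [coeFn_mulOp hh g] with x hx
    rw [hx, RCLike.inner_apply, mul_assoc, Complex.mul_conj']
    push_cast
    rfl
  refine ⟨volume.withDensity fun x => ((‖g x‖₊ ^ 2 : NNReal) : ℝ≥0∞), ?_, ?_, ?_⟩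
  · refine isFiniteMeasure_withDensity ?_
    exact ((lintegral_congr fun x => by
      rw [hnn, Real.enorm_eq_ofReal (by positivity)]).trans_lt hgi.2).ne
  · intro X hX
    have h1 := hin (memLp_indicator_one hX)
    have e : rotatedQuadrature b θ X = (phaseShift b θ ∘L
      (W.symm : Lp ℂ 2 (volume : Measure ℝ) →L[ℂ] H) ∘L mulOp (X.indicator fun _ => 1) ∘L
      (W : H →L[ℂ] Lp ℂ 2 (volume : Measure ℝ)) ∘L phaseShift b (-θ)) := rfl
    rw [e, h1]
    have e2 : ∀ x, X.indicator (fun _ => (1 : ℂ)) x * ((‖g x‖ ^ 2 : ℝ) : ℂ) =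
        ((X.indicator (fun x => ‖g x‖ ^ 2) x : ℝ) : ℂ) := by
      intro x
      by_cases hx : x ∈ X <;> simp [hx]
    simp_rw [e2]
    rw [integral_complex_ofReal, integral_indicator hX, measureReal_def, withDensity_apply _ hX,
      integral_eq_lintegral_of_nonneg_ae (ae_of_all _ fun x => by positivity)
        hgi.aestronglyMeasurable.restrict]
    congr 3
    funext x
    exact hnn x
  · rw [hin (memLp_top_of_bound (by fun_prop) C (ae_of_all _ fun x => by
      simpa using hC x)), integral_withDensity_eq_integral_smul₀ hgm, ← integral_complex_ofReal]
    congr 1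
    ext x
    simp [NNReal.smul_def, mul_comm]

theorem smear_rotatedQuadrature (b : HilbertBasis ℕ ℂ H) (θ : ℝ) (μ : Measure ℝ)
    [IsProbabilityMeasure μ] {X : Set ℝ} (hX : MeasurableSet X) :
    IsWeakIntegral (rotatedQuadrature b θ) (fun x => μ.real {y | y + x ∈ X})
      (smear μ (rotatedQuadrature b θ) X) := by
  have hm : Measurable fun x : ℝ => μ.real {y | y + x ∈ X} := by
    have h1 : MeasurableSet {p : ℝ × ℝ | p.2 + p.1 ∈ X} :=
      (measurable_snd.add measurable_fst) hX
    exact (measurable_measure_prodMk_left h1).ennreal_toReal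
  have h : ∃ A, IsWeakIntegral (rotatedQuadrature b θ) (fun x => μ.real {y | y + x ∈ X}) A :=
    ⟨_, isWeakIntegral_rotatedQuadrature b θ hm (C := 1) fun x => by
      rw [abs_of_nonneg measureReal_nonneg]; exact measureReal_le_one⟩
  rw [smear, weakIntegral, dif_pos h]
  exact h.choose_spec

/-- For ideal detectors there is no smearing. -/
theorem smear_smearingMeasure_one (b : HilbertBasis ℕ ℂ H) (θ : ℝ) {X : Set ℝ}
    (hX : MeasurableSet X) :
    smear (smearingMeasure 1 1) (rotatedQuadrature b θ) X = rotatedQuadrature b θ X := by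
  have e : smearingMeasure 1 1 = Measure.dirac 0 := if_pos ⟨rfl, rfl⟩
  rw [e]
  refine (smear_rotatedQuadrature b θ (Measure.dirac 0) hX).unique fun φ => ?_
  obtain ⟨ν, h1, h2, -⟩ := smear_rotatedQuadrature b θ (Measure.dirac 0) hX φ
  refine ⟨ν, h1, h2, ?_⟩
  rw [← h2 X hX]
  have : (fun x : ℝ => (Measure.dirac (0 : ℝ)).real {y | y + x ∈ X}) = X.indicator 1 := by
    funext x
    have hs : MeasurableSet {y : ℝ | y + x ∈ X} := (measurable_id.add_const x) hX
    rw [measureReal_def, Measure.dirac_apply' _ hs]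
    by_cases hx : x ∈ X <;> simp [hx]
  rw [this, integral_indicator_one hX]

end

end

end Homodyne

/-! For a unit vector φ, an observable E gives the probability measure X ↦ ⟪φ, E X φ⟫. By
polarization, convergence weakly in the sense of probabilities reduces to convergence in
distribution of these measures, and Lévy's continuity theorem reduces that to pointwise convergence
of characteristic functions (`convergesWeaklyInProbabilities_of_charFun`).

The characteristic function of the signal observable at t is the quadratic form of the operator ∫
exp(itx) dE(x) (`signalCharOp`), which has norm at most 1. That of the limit is the quadratic form
of exp(-vt²/2) exp(itQ_θ), with v the variance of the Gaussian measure μ. Since the operators are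
uniformly bounded and the coherent states are total, it suffices to compare matrix elements between
coherent states α and β (`tendsto_inner_of_coherent`). Off-diagonal elements are needed, which is
why operators and not only measures are studied.

These elements are explicit. The generating function ∑ sⁿ E^ε_n is (1 - ε + εs)^N, whose matrix
element is ⟪α, β⟫ exp(ε(s - 1)ᾱβ), and the beam splitter sends |β⟩ ⊗ |z⟩ to a product of coherent
states. With r = |z|, a₁ = -it/(√2 ε₁) and a₂ = it/(√2 ε₂), the matrix element of the signal
operator is thus ⟪α, β⟫ times the exponential of ε₁(exp(a₁/r) - 1)(ᾱ - z̄)(β - z)/2 + ε₂(exp(a₂/r) -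
1)(ᾱ + z̄)(β + z)/2. As r → ∞ the terms of order r cancel because ε₁a₁ + ε₂a₂ = 0, which is the
balance of the detector. What remains is (ε₁a₁² + ε₂a₂²)/4 + it(ᾱ exp(iθ) + β exp(-iθ))/√2
(`tendsto_signal_exponent`).

The first summand equals -(t²/8)(1/ε₁ + 1/ε₂) = -t²/4 - vt²/2. Here -t²/4 and the linear term belong
to exp(itQ_θ), computed in the position representation, where coherent states are Gaussian functions
(`inner_rotatedWeyl_coherent`); the excess -vt²/2 is the exponent of the characteristic function of
μ. -/

namespace Homodyne
noncomputable section

/-! ### Observables through their scalar measures, and Lévy's theorem -/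

section
variable {H : Type*} [NormedAddCommGroup H] [InnerProductSpace ℂ H]

theorem inner_map_eq_polarization (T : H →L[ℂ] H) (x y : H) :
    ⟪x, T y⟫_ℂ = (⟪x + y, T (x + y)⟫_ℂ - ⟪x - y, T (x - y)⟫_ℂ -
      Complex.I * ⟪x + Complex.I • y, T (x + Complex.I • y)⟫_ℂ +
      Complex.I * ⟪x - Complex.I • y, T (x - Complex.I • y)⟫_ℂ) / 4 := by
  have hI : ∀ a : ℂ, Complex.I * (Complex.I * a) = -a := fun a => by
    rw [← mul_assoc, Complex.I_mul_I]; ring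
  simp only [map_add, map_sub, inner_add_left, inner_add_right, map_smul, inner_smul_left,
    inner_smul_right, Complex.conj_I, inner_sub_left, inner_sub_right, mul_add, mul_sub, neg_mul,
    mul_neg, hI]
  ring

/-- Convergence of the quadratic forms implies convergence in the weak operator topology. -/
theorem tendsto_wot_of_inner_self [CompleteSpace H] {ι : Type*} {l : Filter ι}
    {A : ι → H →L[ℂ] H} {B : H →L[ℂ] H}
    (h : ∀ φ, Tendsto (fun i => ⟪φ, A i φ⟫_ℂ) l (𝓝 ⟪φ, B φ⟫_ℂ)) :
    Tendsto (fun i => (ContinuousLinearMapWOT.ofCLM (A i) : H →WOT[ℂ] H)) l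
      (𝓝 (ContinuousLinearMapWOT.ofCLM B)) := by
  rw [ContinuousLinearMapWOT.tendsto_iff_forall_inner_apply_tendsto]
  intro x y
  simp only [ContinuousLinearMapWOT.ofCLM_apply]
  rw [inner_map_eq_polarization]
  refine Tendsto.congr (fun i => (inner_map_eq_polarization (A i) y x).symm) ?_
  exact ((((h _).sub (h _)).sub ((h _).const_mul _)).add ((h _).const_mul _)).div_const _

theorem ofCLM_sum {ι : Type*} (s : Finset ι) (A : ι → H →L[ℂ] H) :
    ∑ i ∈ s, (ContinuousLinearMapWOT.ofCLM (A i) : H →WOT[ℂ] H) =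
      ContinuousLinearMapWOT.ofCLM (∑ i ∈ s, A i) :=
  (map_sum (ContinuousLinearMapWOT.linearEquiv (σ := RingHom.id ℂ) (E := H) (F := H) ℂ).symm A s).symm

theorem hasSum_wot_of_inner_self [CompleteSpace H] {ι : Type*}
    {A : ι → H →L[ℂ] H} {B : H →L[ℂ] H}
    (h : ∀ φ, HasSum (fun i => ⟪φ, A i φ⟫_ℂ) ⟪φ, B φ⟫_ℂ) :
    HasSum (fun i => (ContinuousLinearMapWOT.ofCLM (A i) : H →WOT[ℂ] H))
      (ContinuousLinearMapWOT.ofCLM B) := by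
  rw [HasSum]
  simp_rw [ofCLM_sum]
  refine tendsto_wot_of_inner_self fun φ => ?_
  have := h φ
  rw [HasSum] at this
  refine this.congr fun s => ?_
  rw [sum_apply, inner_sum]

/-- The operator-valued set function `E` is represented by the measures `ν φ`, of mass `‖φ‖²`:
`⟪φ, E X φ⟫ = ν φ X`. -/
structure IsRepresentedBy (E : Set ℝ → H →L[ℂ] H) (ν : H → Measure ℝ) : Prop where
  measure_univ : ∀ φ, ν φ Set.univ = ENNReal.ofReal (‖φ‖ ^ 2)
  inner_eq : ∀ φ X, MeasurableSet X → ⟪φ, E X φ⟫_ℂ = ((ν φ).real X : ℂ)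

namespace IsRepresentedBy

variable {E : Set ℝ → H →L[ℂ] H} {ν : H → Measure ℝ}

theorem isFiniteMeasure (h : IsRepresentedBy E ν) (φ : H) : IsFiniteMeasure (ν φ) :=
  ⟨by rw [h.measure_univ]; exact ENNReal.ofReal_lt_top⟩

theorem isProbabilityMeasure (h : IsRepresentedBy E ν) {φ : H} (hφ : ‖φ‖ = 1) :
    IsProbabilityMeasure (ν φ) :=
  ⟨by rw [h.measure_univ, hφ]; simp⟩

/-- Each axiom can be tested on quadratic forms, where it becomes a property of the measure `ν φ`:
nonnegativity, total mass ‖φ‖², countable additivity. -/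
theorem isObservable [CompleteSpace H] (h : IsRepresentedBy E ν) : IsObservable E where
  isPositive X hX := by
    rw [ContinuousLinearMap.isPositive_iff_complex]
    intro φ
    rw [← inner_conj_symm, h.inner_eq φ X hX]
    simp
  univ := by
    have key : ∀ φ, ⟪E Set.univ φ, φ⟫_ℂ = ⟪(1 : H →L[ℂ] H) φ, φ⟫_ℂ := by
      intro φ
      rw [← inner_conj_symm, h.inner_eq φ _ MeasurableSet.univ, measureReal_def, h.measure_univ,
        ENNReal.toReal_ofReal (by positivity), Complex.conj_ofReal, one_apply_eq_self,
        inner_self_eq_norm_sq_to_K]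
      simp
    exact ContinuousLinearMap.coe_injective
      ((ext_inner_map (E Set.univ : H →ₗ[ℂ] H) ((1 : H →L[ℂ] H) : H →ₗ[ℂ] H)).1 key)
  hasSum_iUnion X hX hd := by
    refine hasSum_wot_of_inner_self fun φ => ?_
    have := h.isFiniteMeasure φ
    simp_rw [h.inner_eq φ _ (hX _)]
    rw [h.inner_eq φ _ (MeasurableSet.iUnion hX), Complex.hasSum_ofReal]
    simp only [measureReal_def]
    rw [measure_iUnion hd hX]
    have hne : ∑' i, ν φ (X i) ≠ ∞ := by
      rw [← measure_iUnion hd hX]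
      exact measure_ne_top _ _
    rw [ENNReal.tsum_toReal_eq fun i => measure_ne_top _ _]
    exact ENNReal.hasSum_toReal hne

end IsRepresentedBy

/-- Lévy's continuity theorem for observables. -/
theorem convergesWeaklyInProbabilities_of_charFun [CompleteSpace H]
    {E : ℕ → Set ℝ → H →L[ℂ] H} {F : Set ℝ → H →L[ℂ] H} {ν : ℕ → H → Measure ℝ}
    {ν' : H → Measure ℝ} (hE : ∀ k, IsRepresentedBy (E k) (ν k)) (hF : IsRepresentedBy F ν')
    (h : ∀ φ, ‖φ‖ = 1 → ∀ t, Tendsto (fun k => charFun (ν k φ) t) atTop (𝓝 (charFun (ν' φ) t))) :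
    ConvergesWeaklyInProbabilities E F where
  isObservable k := (hE k).isObservable
  isObservable_limit := hF.isObservable
  tendsto X hX hX0 := by
    have hunit : ∀ φ, ‖φ‖ = 1 →
        Tendsto (fun k => ⟪φ, E k X φ⟫_ℂ) atTop (𝓝 ⟪φ, F X φ⟫_ℂ) := by
      intro φ hφ
      let μ : ℕ → ProbabilityMeasure ℝ := fun k => ⟨ν k φ, (hE k).isProbabilityMeasure hφ⟩
      let μ' : ProbabilityMeasure ℝ := ⟨ν' φ, hF.isProbabilityMeasure hφ⟩
      have hlim : Tendsto μ atTop (𝓝 μ') := ProbabilityMeasure.tendsto_of_tendsto_charFun (h φ hφ)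
      have h0 : (μ' : Measure ℝ) (frontier X) = 0 := by
        have h1 := hF.inner_eq φ _ (isClosed_frontier (s := X)).measurableSet
        rw [hX0, zero_apply, inner_zero_right] at h1
        have h2 : (ν' φ).real (frontier X) = 0 := by exact_mod_cast h1.symm
        have := hF.isFiniteMeasure φ
        exact (measureReal_eq_zero_iff).1 h2
      have := ProbabilityMeasure.tendsto_measure_of_null_frontier_of_tendsto' hlim h0
      rw [hF.inner_eq φ X hX]
      simp_rw [(hE _).inner_eq φ X hX]
      refine (Complex.continuous_ofReal.tendsto _).comp ?_
      refine (ENNReal.tendsto_toReal ?_).comp this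
      have := hF.isFiniteMeasure φ
      exact measure_ne_top _ _
    refine tendsto_wot_of_inner_self fun φ => ?_
    rcases eq_or_ne φ 0 with rfl | hφ
    · simp
    · have hn : (‖φ‖ : ℂ) ≠ 0 := by simpa using hφ
      -- Only unit vectors give probability measures, so a nonzero vector is normalized first.
      have e : ∀ A : H →L[ℂ] H, ⟪φ, A φ⟫_ℂ =
          (‖φ‖ : ℂ) ^ 2 * ⟪((‖φ‖ : ℂ)⁻¹ • φ), A ((‖φ‖ : ℂ)⁻¹ • φ)⟫_ℂ := by
        intro A
        rw [map_smul, inner_smul_left, inner_smul_right, map_inv₀, Complex.conj_ofReal]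
        field_simp
      simp_rw [e]
      refine (hunit _ ?_).const_mul _
      rw [norm_smul, norm_inv, Complex.norm_real, norm_norm, inv_mul_cancel₀]
      simpa using hφ

/-! ### Testing weak operator convergence on coherent states -/

/-- A uniform bound on the norms makes the family equicontinuous, and the set on which an
equicontinuous family converges to a continuous map is closed. -/
theorem isClosed_setOf_tendsto_of_norm_le {G F : Type*} [SeminormedAddCommGroup G]
    [NormedSpace ℂ G] [SeminormedAddCommGroup F] [NormedSpace ℂ F] {T : ℕ → G →L[ℂ] F}
    {T' : G →L[ℂ] F} {C : ℝ} (hT : ∀ k, ‖T k‖ ≤ C) :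
    IsClosed {x | Tendsto (fun k => T k x) atTop (𝓝 (T' x))} := by
  refine Equicontinuous.isClosed_setOfPred_tendsto (F := fun k x => T k x) (f := fun x => T' x)
    (LipschitzWith.uniformEquicontinuous _ C.toNNReal fun k => ?_).equicontinuous T'.continuous
  refine (T k).lipschitz.weaken ?_
  rw [← NNReal.coe_le_coe, coe_nnnorm]
  exact (hT k).trans (Real.le_coe_toNNReal _)

/-- A property of vectors that is closed, linear and true for coherent states is always true. -/
theorem eq_top_of_coherent_mem (b : HilbertBasis ℕ ℂ H) [CompleteSpace H] (S : Submodule ℂ H)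
    (hS : IsClosed (S : Set H)) (h : ∀ z, coherent b z ∈ S) : S = ⊤ := by
  rw [← hS.submodule_topologicalClosure_eq, Submodule.topologicalClosure_eq_top_iff,
    Submodule.eq_bot_iff]
  intro w hw
  exact eq_zero_of_inner_coherent b w fun z => (Submodule.mem_orthogonal' _ _).1 hw _ (h z)

/-- In each argument separately, the vectors for which convergence holds form a closed subspace
containing all coherent states, hence the whole space. Coherent expectation values alone would not
suffice for this argument. -/
theorem tendsto_inner_of_coherent [CompleteSpace H] (b : HilbertBasis ℕ ℂ H)
    {C : ℕ → H →L[ℂ] H} {C' : H →L[ℂ] H} (hC : ∀ k, ‖C k‖ ≤ 1)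
    (h : ∀ α β, Tendsto (fun k => ⟪coherent b α, C k (coherent b β)⟫_ℂ) atTop
      (𝓝 ⟪coherent b α, C' (coherent b β)⟫_ℂ)) (φ ψ : H) :
    Tendsto (fun k => ⟪φ, C k ψ⟫_ℂ) atTop (𝓝 ⟪φ, C' ψ⟫_ℂ) := by
  have h1 : ∀ α ψ, Tendsto (fun k => ⟪coherent b α, C k ψ⟫_ℂ) atTop
      (𝓝 ⟪coherent b α, C' ψ⟫_ℂ) := by
    intro α ψ
    let S : Submodule ℂ H :=
      { carrier := {ψ | Tendsto (fun k => ⟪coherent b α, C k ψ⟫_ℂ) atTop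
          (𝓝 ⟪coherent b α, C' ψ⟫_ℂ)}
        add_mem' := fun {x y} hx hy => by
          simp only [Set.mem_ofPred_eq, map_add, inner_add_right] at hx hy ⊢
          exact hx.add hy
        zero_mem' := by simp
        smul_mem' := fun c x hx => by
          simp only [Set.mem_ofPred_eq, map_smul, inner_smul_right] at hx ⊢
          exact hx.const_mul c }
    have hS : IsClosed (S : Set H) :=
      isClosed_setOf_tendsto_of_norm_le (C := 1) (T := fun k => innerSL ℂ (coherent b α) ∘L C k)
        (T' := innerSL ℂ (coherent b α) ∘L C') fun k => by
          refine (ContinuousLinearMap.opNorm_comp_le _ _).trans ?_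
          rw [innerSL_apply_norm, norm_coherent, one_mul]
          exact hC k
    have : ψ ∈ S := by rw [eq_top_of_coherent_mem b S hS (h α)]; trivial
    exact this
  -- The inner product is conjugate-linear on the left, so the factors are exchanged by conjugation
  -- to make the expression linear in `φ`.
  have h2 : ∀ φ, Tendsto (fun k => ⟪C k ψ, φ⟫_ℂ) atTop (𝓝 ⟪C' ψ, φ⟫_ℂ) := by
    intro φ
    let S : Submodule ℂ H :=
      { carrier := {φ | Tendsto (fun k => ⟪C k ψ, φ⟫_ℂ) atTop (𝓝 ⟪C' ψ, φ⟫_ℂ)}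
        add_mem' := fun {x y} hx hy => by
          simp only [Set.mem_ofPred_eq, inner_add_right] at hx hy ⊢
          exact hx.add hy
        zero_mem' := by simp
        smul_mem' := fun c x hx => by
          simp only [Set.mem_ofPred_eq, inner_smul_right] at hx ⊢
          exact hx.const_mul c }
    have hS : IsClosed (S : Set H) :=
      isClosed_setOf_tendsto_of_norm_le (C := ‖ψ‖) (T := fun k => innerSL ℂ (C k ψ))
        (T' := innerSL ℂ (C' ψ)) fun k => by
          rw [innerSL_apply_norm]
          exact ((C k).le_of_opNorm_le (hC k) ψ).trans_eq (one_mul _)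
    have : φ ∈ S := by
      rw [eq_top_of_coherent_mem b S hS fun α => ?_]
      · trivial
      · have := (Complex.continuous_conj.tendsto _).comp (h1 α ψ)
        simp only [Function.comp_def, inner_conj_symm] at this
        exact this
    exact this
  have := (Complex.continuous_conj.tendsto _).comp (h2 φ)
  simpa only [Function.comp_def, inner_conj_symm] using this

end

theorem hasSum_of_eq {ι : Type*} {f g : ι → ℂ} {a a' : ℂ} (h : HasSum f a)
    (hfg : ∀ i, g i = f i) (ha : a' = a) : HasSum g a' := by
  rw [ha, funext hfg]
  exact h

theorem hasSum_prod_mul {f g : ℕ → ℂ} {a a' : ℂ} (hf : HasSum f a) (hg : HasSum g a') :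
    HasSum (fun p : ℕ × ℕ => f p.1 * g p.2) (a * a') :=
  hf.mul hg (summable_mul_of_summable_norm hf.summable.norm hg.summable.norm)

/-! ### Families of operators with ∑ Kₚ* Kₚ ≤ 1 -/

section
variable {ι G : Type*} [NormedAddCommGroup G] [InnerProductSpace ℂ G]

/-- The family `K` of operators satisfies `∑ₚ Kₚ* Kₚ ≤ 1`. -/
def IsSubnormalized (K : ι → G →L[ℂ] G) : Prop :=
  ∀ (s : Finset ι) (ψ : G), ∑ p ∈ s, ‖K p ψ‖ ^ 2 ≤ ‖ψ‖ ^ 2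

theorem IsSubnormalized.subtype {K : ι → G →L[ℂ] G} (h : IsSubnormalized K) (S : Set ι) :
    IsSubnormalized fun p : S => K p := fun s ψ => by
  have := h (s.map (Function.Embedding.subtype _)) ψ
  rwa [Finset.sum_map] at this

theorem IsSubnormalized.smul {K : ι → G →L[ℂ] G} (h : IsSubnormalized K) {f : ι → ℂ}
    (hf : ∀ p, ‖f p‖ ≤ 1) : IsSubnormalized fun p => f p • K p := fun s ψ => by
  refine (Finset.sum_le_sum fun p _ => ?_).trans (h s ψ)
  rw [smul_apply, norm_smul]
  gcongr
  exact mul_le_of_le_one_left (norm_nonneg _) (hf p)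

theorem IsSubnormalized.memℓp {K : ι → G →L[ℂ] G} (h : IsSubnormalized K) (ψ : G) :
    Memℓp (fun p => K p ψ) 2 := by
  refine memℓp_gen' (C := ‖ψ‖ ^ 2) fun s => ?_
  simpa using h s ψ

/-- The operator `ψ ↦ (Kₚ ψ)ₚ` into the Hilbert sum. -/
def IsSubnormalized.stack {K : ι → G →L[ℂ] G} (h : IsSubnormalized K) :
    G →L[ℂ] lp (fun _ : ι => G) 2 :=
  LinearMap.mkContinuous
    { toFun := fun ψ => ⟨fun p => K p ψ, h.memℓp ψ⟩
      map_add' := fun x y => by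
        ext p
        exact map_add (K p) x y
      map_smul' := fun a x => by
        ext p
        exact map_smul (K p) a x } 1 fun ψ => by
      rw [one_mul]
      refine lp.norm_le_of_forall_sum_le (by norm_num) (norm_nonneg _) fun s => ?_
      simpa using h s ψ

theorem IsSubnormalized.stack_apply {K : ι → G →L[ℂ] G} (h : IsSubnormalized K) (ψ : G) (p : ι) :
    h.stack ψ p = K p ψ := rfl

theorem IsSubnormalized.norm_stack_le {K : ι → G →L[ℂ] G} (h : IsSubnormalized K) :
    ‖h.stack‖ ≤ 1 :=
  LinearMap.mkContinuous_norm_le _ zero_le_one _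

/-- The operator `∑ₚ Kₚ* Lₚ`. -/
def crossSum [CompleteSpace G] {K L : ι → G →L[ℂ] G} (hK : IsSubnormalized K)
    (hL : IsSubnormalized L) : G →L[ℂ] G :=
  hK.stack.adjoint ∘L hL.stack

/-- The sum ∑ Kₚ* Lₚ factors through the Hilbert sum as the adjoint of one contraction after
another. This replaces a Cauchy–Schwarz estimate and yields the uniform bound needed for the density
argument. -/
theorem norm_crossSum_le [CompleteSpace G] {K L : ι → G →L[ℂ] G} (hK : IsSubnormalized K)
    (hL : IsSubnormalized L) : ‖crossSum hK hL‖ ≤ 1 := by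
  refine (ContinuousLinearMap.opNorm_comp_le _ _).trans ?_
  rw [LinearIsometryEquiv.norm_map]
  exact mul_le_one₀ hK.norm_stack_le (norm_nonneg _) hL.norm_stack_le

theorem hasSum_inner_crossSum [CompleteSpace G] {K L : ι → G →L[ℂ] G} (hK : IsSubnormalized K)
    (hL : IsSubnormalized L) (x y : G) :
    HasSum (fun p => ⟪K p x, L p y⟫_ℂ) ⟪x, crossSum hK hL y⟫_ℂ := by
  have := lp.hasSum_inner (𝕜 := ℂ) (hK.stack x) (hL.stack y)
  rwa [← ContinuousLinearMap.adjoint_inner_right] at this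

variable {κ : Type*} {v : κ → G}

theorem hasSum_inner_linearCombination {K : ι → G →L[ℂ] G}
    (h : ∀ i j, HasSum (fun p => ⟪K p (v i), K p (v j)⟫_ℂ) ⟪v i, v j⟫_ℂ) (x y : κ →₀ ℂ) :
    HasSum (fun p => ⟪K p (Finsupp.linearCombination ℂ v x),
        K p (Finsupp.linearCombination ℂ v y)⟫_ℂ)
      ⟪Finsupp.linearCombination ℂ v x, Finsupp.linearCombination ℂ v y⟫_ℂ := by
  simp only [Finsupp.linearCombination_apply, Finsupp.sum, map_sum, map_smul, sum_inner, inner_sum,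
    inner_smul_left, inner_smul_right]
  exact hasSum_sum fun i _ => (hasSum_sum fun j _ => (h _ _).mul_left _).mul_left _

theorem hasSum_norm_sq_linearCombination {K : ι → G →L[ℂ] G}
    (h : ∀ i j, HasSum (fun p => ⟪K p (v i), K p (v j)⟫_ℂ) ⟪v i, v j⟫_ℂ) (x : κ →₀ ℂ) :
    HasSum (fun p => ‖K p (Finsupp.linearCombination ℂ v x)‖ ^ 2)
      (‖Finsupp.linearCombination ℂ v x‖ ^ 2) := by
  rw [← Complex.hasSum_ofReal]
  have := hasSum_inner_linearCombination h x x
  simp_rw [inner_self_eq_norm_sq_to_K] at this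
  exact_mod_cast this

/-- By sesquilinearity the relation ∑ Kₚ* Kₚ = 1, given on a total family, holds on its span. Each
finite partial sum is continuous, so the inequality survives passage to the closure. -/
theorem isSubnormalized_of_hasSum {K : ι → G →L[ℂ] G}
    (hv : DenseRange (Finsupp.linearCombination ℂ v))
    (h : ∀ i j, HasSum (fun p => ⟪K p (v i), K p (v j)⟫_ℂ) ⟪v i, v j⟫_ℂ) :
    IsSubnormalized K := by
  intro s ψ
  refine hv.induction_on (p := fun ψ => ∑ p ∈ s, ‖K p ψ‖ ^ 2 ≤ ‖ψ‖ ^ 2) ψ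
    (isClosed_le (by fun_prop) (by fun_prop)) fun x => ?_
  exact sum_le_hasSum s (fun p _ => by positivity) (hasSum_norm_sq_linearCombination h x)

/-- The infinite sum is not visibly continuous in `ψ`, but it equals ‖`hK.stack ψ`‖². The bounded
operator `hK.stack` is isometric on a dense subspace, hence everywhere. -/
theorem hasSum_norm_sq {K : ι → G →L[ℂ] G} (hv : DenseRange (Finsupp.linearCombination ℂ v))
    (h : ∀ i j, HasSum (fun p => ⟪K p (v i), K p (v j)⟫_ℂ) ⟪v i, v j⟫_ℂ) (ψ : G) :
    HasSum (fun p => ‖K p ψ‖ ^ 2) (‖ψ‖ ^ 2) := by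
  have hK := isSubnormalized_of_hasSum hv h
  have h1 : ∀ ψ, HasSum (fun p => ‖K p ψ‖ ^ 2) (‖hK.stack ψ‖ ^ 2) := fun ψ => by
    have := lp.hasSum_norm (p := 2) (by norm_num) (hK.stack ψ)
    simpa [hK.stack_apply] using this
  have h2 : ‖hK.stack ψ‖ = ‖ψ‖ := by
    refine hv.induction_on (p := fun ψ => ‖hK.stack ψ‖ = ‖ψ‖) ψ
      (isClosed_eq (by fun_prop) (by fun_prop)) fun x => ?_
    exact (sq_eq_sq₀ (norm_nonneg _) (norm_nonneg _)).1
      ((h1 _).unique (hasSum_norm_sq_linearCombination h x))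
  rw [← h2]
  exact h1 ψ

end

/-! ### Detector effects, their square roots and generating functions -/

section
variable {H K : Type*} [NormedAddCommGroup H] [InnerProductSpace ℂ H]
  [NormedAddCommGroup K] [InnerProductSpace ℂ K]

/-- Totality of the products of coherent states is used twice: first to identify the images of such
products, then, through the adjoints, to identify the operators themselves. -/
theorem ext_coherent_tensor [CompleteSpace H] [CompleteSpace K] (b : HilbertBasis ℕ ℂ H)
    (c : HilbertBasis ℕ ℂ K) {S T : HilbertTensor H K →L[ℂ] HilbertTensor H K}
    (h : ∀ α β α' β', ⟪S (tensorVec (coherent b α) (coherent c β)),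
      tensorVec (coherent b α') (coherent c β')⟫_ℂ =
      ⟪T (tensorVec (coherent b α) (coherent c β)),
      tensorVec (coherent b α') (coherent c β')⟫_ℂ) : S = T := by
  have h1 : ∀ α β, S (tensorVec (coherent b α) (coherent c β)) =
      T (tensorVec (coherent b α) (coherent c β)) := fun α β => by
    rw [← sub_eq_zero]
    refine eq_zero_of_inner_coherent_tensor b c _ fun α' β' => ?_
    rw [inner_sub_left, h, sub_self]
  have h2 : S.adjoint = T.adjoint := by
    ext w
    rw [← sub_eq_zero]
    refine eq_zero_of_inner_coherent_tensor b c _ fun α β => ?_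
    rw [inner_sub_left, ContinuousLinearMap.adjoint_inner_left,
      ContinuousLinearMap.adjoint_inner_left, h1, sub_self]
  exact ContinuousLinearMap.adjoint.injective h2

/-- If S*S = A and R*R = B, then (S ⊗ R)*(S ⊗ R) = A ⊗ B. This supplies a square root of the
two-mode effects without functional calculus. -/
theorem inner_tensorOp_tensorOp [CompleteSpace H] [CompleteSpace K] (b : HilbertBasis ℕ ℂ H)
    (c : HilbertBasis ℕ ℂ K) {A S : H →L[ℂ] H} {B R : K →L[ℂ] K}
    (hA : ∀ φ ψ, ⟪S φ, S ψ⟫_ℂ = ⟪φ, A ψ⟫_ℂ) (hB : ∀ φ ψ, ⟪R φ, R ψ⟫_ℂ = ⟪φ, B ψ⟫_ℂ)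
    (x y : HilbertTensor H K) :
    ⟪tensorOp S R x, tensorOp S R y⟫_ℂ = ⟪x, tensorOp A B y⟫_ℂ := by
  have : (tensorOp S R).adjoint ∘L tensorOp S R = tensorOp A B := by
    refine ext_coherent_tensor b c fun α β α' β' => ?_
    rw [ContinuousLinearMap.comp_apply, ContinuousLinearMap.adjoint_inner_left,
      tensorOp_tensorVec, tensorOp_tensorVec, tensorOp_tensorVec, inner_tensorVec, inner_tensorVec,
      ← inner_conj_symm (A _), ← inner_conj_symm (B _), ← hA, ← hB, inner_conj_symm,
      inner_conj_symm]
  rw [← this, ContinuousLinearMap.comp_apply, ContinuousLinearMap.adjoint_inner_right]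

theorem hasSum_inner_diagOp (b : HilbertBasis ℕ ℂ H) {d : ℕ → ℂ} {C : ℝ} (h : ∀ i, ‖d i‖ ≤ C)
    (φ ψ : H) : HasSum (fun l => d l * ((starRingEnd ℂ) (b.repr φ l) * b.repr ψ l))
      ⟪φ, diagOp b d ψ⟫_ℂ := by
  have := lp.hasSum_inner (𝕜 := ℂ) (b.repr φ) (b.repr (diagOp b d ψ))
  rw [b.repr.inner_map_map] at this
  refine hasSum_of_eq this (fun l => ?_) rfl
  rw [repr_diagOp b h, RCLike.inner_apply]
  ring

/-- The probability that `n` of `m` photons are detected. -/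
def detectionProb (ε : ℝ) (n m : ℕ) : ℝ := m.choose n * ε ^ n * (1 - ε) ^ (m - n)

theorem detectionProb_nonneg {ε : ℝ} (hε : ε ∈ Set.Ioc (0 : ℝ) 1) (n m : ℕ) :
    0 ≤ detectionProb ε n m := by
  have h1 := hε.1.le
  have h2 : 0 ≤ 1 - ε := sub_nonneg.2 hε.2
  rw [detectionProb]
  positivity

/-- For n ≤ m this is one of the nonnegative terms of the binomial expansion of (ε + (1 - ε))^m = 1.
-/
theorem detectionProb_le_one {ε : ℝ} (hε : ε ∈ Set.Ioc (0 : ℝ) 1) (n m : ℕ) :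
    detectionProb ε n m ≤ 1 := by
  rcases lt_or_ge m n with h | h
  · simp [detectionProb, Nat.choose_eq_zero_of_lt h]
  · have h1 := add_pow ε (1 - ε) m
    rw [add_sub_cancel, one_pow] at h1
    rw [h1]
    refine le_trans (le_of_eq ?_) (Finset.single_le_sum (f := fun k => ε ^ k * (1 - ε) ^ (m - k) *
      (m.choose k : ℝ)) (fun k _ => ?_) (Finset.mem_range_succ_iff.2 h))
    · rw [detectionProb]; ring
    · have := detectionProb_nonneg hε k m
      rw [detectionProb] at this
      linarith

theorem norm_detectionProb_le {ε : ℝ} (hε : ε ∈ Set.Ioc (0 : ℝ) 1) (n m : ℕ) :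
    ‖(detectionProb ε n m : ℂ)‖ ≤ 1 := by
  rw [Complex.norm_real, Real.norm_of_nonneg (detectionProb_nonneg hε n m)]
  exact detectionProb_le_one hε n m

/-- The positive square root of the effect `detectorEffect b ε n`. -/
def sqrtEffect (b : HilbertBasis ℕ ℂ H) (ε : ℝ) (n : ℕ) : H →L[ℂ] H :=
  diagOp b fun m => (√(detectionProb ε n m) : ℂ)

theorem inner_sqrtEffect (b : HilbertBasis ℕ ℂ H) {ε : ℝ} (hε : ε ∈ Set.Ioc (0 : ℝ) 1) (n : ℕ)
    (φ ψ : H) :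
    ⟪sqrtEffect b ε n φ, sqrtEffect b ε n ψ⟫_ℂ = ⟪φ, detectorEffect b ε n ψ⟫_ℂ := by
  have hs : ∀ m, ‖(√(detectionProb ε n m) : ℂ)‖ ≤ 1 := fun m => by
    rw [Complex.norm_real, Real.norm_of_nonneg (Real.sqrt_nonneg _), Real.sqrt_le_one]
    exact detectionProb_le_one hε n m
  refine (hasSum_inner_diagOp b hs _ ψ).unique ?_
  refine hasSum_of_eq (hasSum_inner_diagOp b (norm_detectionProb_le hε n) φ ψ) (fun m => ?_) rfl
  rw [sqrtEffect, repr_diagOp b hs, map_mul, Complex.conj_ofReal, ← mul_assoc, ← mul_assoc,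
    ← Complex.ofReal_mul, Real.mul_self_sqrt (detectionProb_nonneg hε n m), mul_assoc]

theorem hasSum_detectionProb (ε : ℝ) (x : ℂ) (n : ℕ) :
    HasSum (fun m : ℕ => (detectionProb ε n m : ℂ) * (x ^ m / m.factorial))
      ((ε * x) ^ n / n.factorial * Complex.exp ((1 - ε) * x)) := by
  -- The terms with m < n vanish with the binomial coefficient. After the shift m ↦ m + n,
  -- cancelling (m + n)! leaves (εx)^n/n! times the exponential series of (1 - ε)x.
  rw [← hasSum_nat_add_iff' n, Finset.sum_eq_zero, sub_zero]
  · have h := NormedSpace.expSeries_div_hasSum_exp (𝔸 := ℂ) ((1 - ε) * x)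
    rw [← Complex.exp_eq_exp_ℂ] at h
    refine hasSum_of_eq (h.mul_left ((ε * x) ^ n / n.factorial)) (fun m => ?_) rfl
    have h1 : ((m + n).choose n : ℂ) * n.factorial * m.factorial = (m + n).factorial := by
      have := Nat.add_choose_mul_factorial_mul_factorial m n
      rw [mul_right_comm]
      exact_mod_cast this
    rw [detectionProb, Nat.add_sub_cancel, ← h1, mul_pow, mul_pow (1 - ε : ℂ)]
    have h2 : ((m + n).choose n : ℂ) ≠ 0 := by
      exact_mod_cast (Nat.choose_pos (Nat.le_add_left n m)).ne'
    have h3 : (n.factorial : ℂ) ≠ 0 := by exact_mod_cast n.factorial_ne_zero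
    have h4 : (m.factorial : ℂ) ≠ 0 := by exact_mod_cast m.factorial_ne_zero
    push_cast
    field_simp
    ring
  · intro m hm
    rw [detectionProb, Nat.choose_eq_zero_of_lt (Finset.mem_range.1 hm)]
    simp

theorem conj_repr_coherent_mul (b : HilbertBasis ℕ ℂ H) (α β : ℂ) (l : ℕ) :
    (starRingEnd ℂ) (b.repr (coherent b α) l) * b.repr (coherent b β) l =
      Complex.exp (-(‖α‖ ^ 2 / 2 : ℝ) - (‖β‖ ^ 2 / 2 : ℝ)) *
        (((starRingEnd ℂ) α * β) ^ l / l.factorial) := by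
  rw [repr_coherent, repr_coherent]
  have h1 : (√(l.factorial : ℝ) : ℂ) * (√(l.factorial : ℝ) : ℂ) = l.factorial := by
    rw [← Complex.ofReal_mul, Real.mul_self_sqrt (by positivity)]; simp
  have h2 : Complex.exp (-(‖α‖ ^ 2 / 2 : ℝ) - (‖β‖ ^ 2 / 2 : ℝ)) =
      (Real.exp (-‖α‖ ^ 2 / 2) : ℂ) * (Real.exp (-‖β‖ ^ 2 / 2) : ℂ) := by
    rw [← Complex.ofReal_mul, ← Real.exp_add]; push_cast; congr 1; ring
  rw [h2, ← h1]
  simp only [map_mul, map_div₀, map_pow, Complex.conj_ofReal]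
  ring

theorem inner_detectorEffect_coherent (b : HilbertBasis ℕ ℂ H) {ε : ℝ}
    (hε : ε ∈ Set.Ioc (0 : ℝ) 1) (n : ℕ) (α β : ℂ) :
    ⟪coherent b α, detectorEffect b ε n (coherent b β)⟫_ℂ =
      Complex.exp (-(‖α‖ ^ 2 / 2 : ℝ) - (‖β‖ ^ 2 / 2 : ℝ) + (1 - ε) * ((starRingEnd ℂ) α * β)) *
        ((ε * ((starRingEnd ℂ) α * β)) ^ n / n.factorial) := by
  have h := hasSum_inner_diagOp b (norm_detectionProb_le hε n) (coherent b α) (coherent b β)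
  simp_rw [conj_repr_coherent_mul] at h
  refine h.unique ?_
  rw [Complex.exp_add]
  refine hasSum_of_eq ((hasSum_detectionProb ε ((starRingEnd ℂ) α * β) n).mul_left
    (Complex.exp (-(‖α‖ ^ 2 / 2 : ℝ) - (‖β‖ ^ 2 / 2 : ℝ)))) (fun m => ?_) ?_
  · ring
  · ring

/-- The generating function of the effects is (1 - ε + εs)^N, and q^N between coherent states
replaces ᾱβ in the exponent of ⟪α, β⟫ by qᾱβ. -/
theorem hasSum_detectorEffect_coherent (b : HilbertBasis ℕ ℂ H) {ε : ℝ}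
    (hε : ε ∈ Set.Ioc (0 : ℝ) 1) (s α β : ℂ) :
    HasSum (fun n => s ^ n * ⟪coherent b α, detectorEffect b ε n (coherent b β)⟫_ℂ)
      (Complex.exp (-(‖α‖ ^ 2 / 2 : ℝ) - (‖β‖ ^ 2 / 2 : ℝ) +
        (1 - ε + ε * s) * ((starRingEnd ℂ) α * β))) := by
  simp_rw [inner_detectorEffect_coherent b hε]
  have h := NormedSpace.expSeries_div_hasSum_exp (𝔸 := ℂ) (ε * s * ((starRingEnd ℂ) α * β))
  rw [← Complex.exp_eq_exp_ℂ] at h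
  refine hasSum_of_eq (h.mul_left (Complex.exp (-(‖α‖ ^ 2 / 2 : ℝ) - (‖β‖ ^ 2 / 2 : ℝ) +
    (1 - ε) * ((starRingEnd ℂ) α * β)))) (fun n => ?_) ?_
  · rw [mul_pow, mul_pow (ε * s : ℂ), mul_pow (ε : ℂ) s]; ring
  · rw [← Complex.exp_add]; congr 1; ring

theorem hasSum_detectorEffects_coherent (b : HilbertBasis ℕ ℂ H) (c : HilbertBasis ℕ ℂ K)
    {ε₁ ε₂ : ℝ} (hε₁ : ε₁ ∈ Set.Ioc (0 : ℝ) 1) (hε₂ : ε₂ ∈ Set.Ioc (0 : ℝ) 1) (s u α β α' β' : ℂ) :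
    HasSum (fun p : ℕ × ℕ =>
        s ^ p.1 * ⟪coherent b α, detectorEffect b ε₁ p.1 (coherent b α')⟫_ℂ *
        (u ^ p.2 * ⟪coherent c β, detectorEffect c ε₂ p.2 (coherent c β')⟫_ℂ))
      (Complex.exp (-(‖α‖ ^ 2 / 2 : ℝ) - (‖α'‖ ^ 2 / 2 : ℝ) +
          (1 - ε₁ + ε₁ * s) * ((starRingEnd ℂ) α * α')) *
        Complex.exp (-(‖β‖ ^ 2 / 2 : ℝ) - (‖β'‖ ^ 2 / 2 : ℝ) +
          (1 - ε₂ + ε₂ * u) * ((starRingEnd ℂ) β * β'))) := by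
  have h := hasSum_prod_mul (hasSum_detectorEffect_coherent b hε₁ s α α')
    (hasSum_detectorEffect_coherent c hε₂ u β β')
  convert h using 1

end

/-! ### Outcome distributions and their characteristic functions -/

section
variable {ι G : Type*} [NormedAddCommGroup G] [InnerProductSpace ℂ G]

/-- The distribution of the outcome `g p` of a measurement with operators `Kₚ` in the state `ψ`. -/
def outcomeMeasure (K : ι → G →L[ℂ] G) (g : ι → ℝ) (ψ : G) : Measure ℝ :=
  Measure.sum fun p => ENNReal.ofReal (‖K p ψ‖ ^ 2) • Measure.dirac (g p)

/-- Subnormalization makes the real series summable, so `ENNReal.ofReal` may be pulled out of the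
sum of point masses. -/
theorem outcomeMeasure_apply {K : ι → G →L[ℂ] G} (hK : IsSubnormalized K) (g : ι → ℝ) (ψ : G)
    {X : Set ℝ} (hX : MeasurableSet X) :
    outcomeMeasure K g ψ X = ENNReal.ofReal (∑' p : {p // g p ∈ X}, ‖K p ψ‖ ^ 2) := by
  have hs : Summable fun p : {p // g p ∈ X} => ‖K p ψ‖ ^ 2 :=
    summable_of_sum_le (fun _ => by positivity) fun u => hK.subtype {p | g p ∈ X} u ψ
  rw [outcomeMeasure, Measure.sum_apply _ hX, ENNReal.ofReal_tsum_of_nonneg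
    (fun _ => by positivity) hs]
  have h := tsum_subtype {p | g p ∈ X} fun p => ENNReal.ofReal (‖K p ψ‖ ^ 2)
  refine Eq.trans (tsum_congr fun p => ?_) h.symm
  rw [Measure.smul_apply, Measure.dirac_apply' _ hX, smul_eq_mul]
  by_cases hp : g p ∈ X
  · rw [Set.indicator_of_mem hp, Set.indicator_of_mem (show p ∈ {p | g p ∈ X} from hp)]
    simp
  · rw [Set.indicator_of_notMem hp, Set.indicator_of_notMem (show p ∉ {p | g p ∈ X} from hp)]
    simp

theorem isFiniteMeasure_outcomeMeasure {K : ι → G →L[ℂ] G} (hK : IsSubnormalized K) (g : ι → ℝ)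
    (ψ : G) : IsFiniteMeasure (outcomeMeasure K g ψ) :=
  ⟨by rw [outcomeMeasure_apply hK g ψ MeasurableSet.univ]; exact ENNReal.ofReal_lt_top⟩

theorem hasSum_charFun_outcomeMeasure {K : ι → G →L[ℂ] G} (hK : IsSubnormalized K) (g : ι → ℝ)
    (ψ : G) (t : ℝ) :
    HasSum (fun p => Complex.exp (t * g p * Complex.I) * ⟪K p ψ, K p ψ⟫_ℂ)
      (charFun (outcomeMeasure K g ψ) t) := by
  have := isFiniteMeasure_outcomeMeasure hK g ψ
  rw [charFun_apply_real]
  have hi : Integrable (fun x : ℝ => Complex.exp (t * x * Complex.I)) (outcomeMeasure K g ψ) := by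
    refine Integrable.of_bound (by fun_prop) 1 (ae_of_all _ fun x => ?_)
    rw [← Complex.ofReal_mul, Complex.norm_exp_ofReal_mul_I]
  have h := hasSum_integral_measure hi
  refine hasSum_of_eq h (fun p => ?_) rfl
  rw [integral_smul_measure, integral_dirac, ENNReal.toReal_ofReal (by positivity),
    inner_self_eq_norm_sq_to_K, Complex.real_smul, mul_comm]
  push_cast
  rfl

/-- The characteristic function becomes the quadratic form of one bounded operator, which also has
off-diagonal matrix elements. The phases have modulus 1, so the modified family remains
subnormalized. -/
theorem charFun_outcomeMeasure [CompleteSpace G] {K : ι → G →L[ℂ] G} (hK : IsSubnormalized K)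
    (g : ι → ℝ) (ψ : G) (t : ℝ)
    (hL : IsSubnormalized fun p => Complex.exp (t * g p * Complex.I) • K p) :
    charFun (outcomeMeasure K g ψ) t = ⟪ψ, crossSum hK hL ψ⟫_ℂ := by
  refine (hasSum_charFun_outcomeMeasure hK g ψ t).unique ?_
  refine hasSum_of_eq (hasSum_inner_crossSum hK hL ψ ψ) (fun p => ?_) rfl
  rw [smul_apply, inner_smul_right]

end

/-! ### The signal observable and its characteristic operator -/

section
variable {H K : Type*} [NormedAddCommGroup H] [InnerProductSpace ℂ H] [CompleteSpace H]
  [NormedAddCommGroup K] [InnerProductSpace ℂ K] [CompleteSpace K]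
  (b : HilbertBasis ℕ ℂ H) (c : HilbertBasis ℕ ℂ K) {ε₁ ε₂ : ℝ}

/-- The square root of the effect of detecting `p.1` and `p.2` photons in the two modes. -/
def kraus (ε₁ ε₂ : ℝ) (p : ℕ × ℕ) : HilbertTensor H K →L[ℂ] HilbertTensor H K :=
  tensorOp (sqrtEffect b ε₁ p.1) (sqrtEffect c ε₂ p.2)

theorem inner_kraus (hε₁ : ε₁ ∈ Set.Ioc (0 : ℝ) 1) (hε₂ : ε₂ ∈ Set.Ioc (0 : ℝ) 1) (p : ℕ × ℕ)
    (x y : HilbertTensor H K) :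
    ⟪kraus b c ε₁ ε₂ p x, kraus b c ε₁ ε₂ p y⟫_ℂ =
      ⟪x, tensorOp (detectorEffect b ε₁ p.1) (detectorEffect c ε₂ p.2) y⟫_ℂ :=
  inner_tensorOp_tensorOp b c (inner_sqrtEffect b hε₁ p.1) (inner_sqrtEffect c hε₂ p.2) x y

/-- The generating function of the two modes serves twice: s = u = 1 gives the normalization ∑ Kₚ*
Kₚ = 1, and s, u of modulus 1 give the characteristic operator. -/
theorem hasSum_inner_kraus_coherent (hε₁ : ε₁ ∈ Set.Ioc (0 : ℝ) 1)
    (hε₂ : ε₂ ∈ Set.Ioc (0 : ℝ) 1) (s u α β α' β' : ℂ) :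
    HasSum (fun p : ℕ × ℕ => s ^ p.1 * u ^ p.2 *
        ⟪kraus b c ε₁ ε₂ p (tensorVec (coherent b α) (coherent c β)),
          kraus b c ε₁ ε₂ p (tensorVec (coherent b α') (coherent c β'))⟫_ℂ)
      (Complex.exp (-(‖α‖ ^ 2 / 2 : ℝ) - (‖α'‖ ^ 2 / 2 : ℝ) +
          (1 - ε₁ + ε₁ * s) * ((starRingEnd ℂ) α * α')) *
        Complex.exp (-(‖β‖ ^ 2 / 2 : ℝ) - (‖β'‖ ^ 2 / 2 : ℝ) +
          (1 - ε₂ + ε₂ * u) * ((starRingEnd ℂ) β * β'))) := by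
  refine hasSum_of_eq (hasSum_detectorEffects_coherent b c hε₁ hε₂ s u α β α' β')
    (fun p => ?_) rfl
  rw [inner_kraus b c hε₁ hε₂, tensorOp_tensorVec, inner_tensorVec]
  ring

theorem hasSum_inner_kraus (hε₁ : ε₁ ∈ Set.Ioc (0 : ℝ) 1) (hε₂ : ε₂ ∈ Set.Ioc (0 : ℝ) 1)
    (i j : ℂ × ℂ) :
    HasSum (fun p => ⟪kraus b c ε₁ ε₂ p (tensorVec (coherent b i.1) (coherent c i.2)),
        kraus b c ε₁ ε₂ p (tensorVec (coherent b j.1) (coherent c j.2))⟫_ℂ)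
      ⟪tensorVec (coherent b i.1) (coherent c i.2), tensorVec (coherent b j.1) (coherent c j.2)⟫_ℂ := by
  refine hasSum_of_eq (hasSum_inner_kraus_coherent b c hε₁ hε₂ 1 1 i.1 i.2 j.1 j.2)
    (fun p => by rw [one_pow, one_pow, one_mul, one_mul]) ?_
  rw [inner_tensorVec, inner_coherent, inner_coherent]
  congr 2 <;> ring

theorem isSubnormalized_kraus (hε₁ : ε₁ ∈ Set.Ioc (0 : ℝ) 1) (hε₂ : ε₂ ∈ Set.Ioc (0 : ℝ) 1) :
    IsSubnormalized (kraus b c ε₁ ε₂) :=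
  isSubnormalized_of_hasSum (denseRange_coherentPairs b c) (hasSum_inner_kraus b c hε₁ hε₂)

theorem hasSum_norm_sq_kraus (hε₁ : ε₁ ∈ Set.Ioc (0 : ℝ) 1) (hε₂ : ε₂ ∈ Set.Ioc (0 : ℝ) 1)
    (ψ : HilbertTensor H K) : HasSum (fun p => ‖kraus b c ε₁ ε₂ p ψ‖ ^ 2) (‖ψ‖ ^ 2) :=
  hasSum_norm_sq (denseRange_coherentPairs b c) (hasSum_inner_kraus b c hε₁ hε₂) ψ

/-- The scaled photon number difference. -/
def scaledDifference (ε₁ ε₂ : ℝ) (z : ℂ) (p : ℕ × ℕ) : ℝ :=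
  1 / (√2 * ‖z‖) * (p.2 / ε₂ - p.1 / ε₁)

theorem inner_differenceObservable (hε₁ : ε₁ ∈ Set.Ioc (0 : ℝ) 1) (hε₂ : ε₂ ∈ Set.Ioc (0 : ℝ) 1)
    (z : ℂ) (X : Set ℝ) (ψ : HilbertTensor H K) :
    ⟪ψ, differenceObservable b c ε₁ ε₂ z X ψ⟫_ℂ =
      ((∑' p : {p // scaledDifference ε₁ ε₂ z p ∈ X}, ‖kraus b c ε₁ ε₂ p ψ‖ ^ 2 : ℝ) : ℂ) := by
  have hK := (isSubnormalized_kraus b c hε₁ hε₂).subtype {p | scaledDifference ε₁ ε₂ z p ∈ X}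
  -- The defining infinite sum could take a default value. Its convergence in the weak operator
  -- topology is established by exhibiting the limit, which is bounded by subnormalization.
  have h1 : differenceObservable b c ε₁ ε₂ z X = crossSum hK hK := by
    have h : HasSum (fun p : {p : ℕ × ℕ // 1 / (√2 * ‖z‖) * (p.2 / ε₂ - p.1 / ε₁) ∈ X} =>
        (ContinuousLinearMapWOT.ofCLM
          (tensorOp (detectorEffect b ε₁ p.1.1) (detectorEffect c ε₂ p.1.2)) :
            HilbertTensor H K →WOT[ℂ] HilbertTensor H K))
        (ContinuousLinearMapWOT.ofCLM (crossSum hK hK)) :=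
      hasSum_wot_of_inner_self fun φ => hasSum_of_eq (hasSum_inner_crossSum hK hK φ φ)
        (fun p => (inner_kraus b c hε₁ hε₂ p.1 φ φ).symm) rfl
    rw [differenceObservable, h.tsum_eq]
  have h2 := hasSum_inner_crossSum hK hK ψ ψ
  simp_rw [inner_self_eq_norm_sq_to_K] at h2
  rw [h1, ← h2.tsum_eq, Complex.ofReal_tsum]
  push_cast
  rfl

/-- The state `U (φ ⊗ |z⟩)` that reaches the detectors. -/
def outputState (z : ℂ) : H →L[ℂ] HilbertTensor H K :=
  beamSplitter b c ∘L tensorRight H (coherent c z)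

theorem norm_outputState (z : ℂ) (φ : H) : ‖outputState b c z φ‖ = ‖φ‖ := by
  rw [outputState, ContinuousLinearMap.comp_apply, norm_beamSplitter_apply, tensorRight_apply,
    ← sq_eq_sq₀ (norm_nonneg _) (norm_nonneg _)]
  have h := inner_tensorVec φ φ (coherent c z) (coherent c z)
  simp only [inner_self_eq_norm_sq_to_K, norm_coherent] at h
  have h' : (((‖tensorVec φ (coherent c z)‖ ^ 2 : ℝ)) : ℂ) = ((‖φ‖ ^ 2 : ℝ) : ℂ) := by
    simpa using h
  exact_mod_cast h'

theorem norm_outputState_le (z : ℂ) : ‖outputState b c z‖ ≤ 1 :=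
  ContinuousLinearMap.opNorm_le_bound _ zero_le_one fun φ => by rw [norm_outputState, one_mul]

theorem outputState_coherent (z α : ℂ) : outputState b c z (coherent b α) =
    tensorVec (coherent b ((α - z) / √2)) (coherent c ((α + z) / √2)) :=
  beamSplitter_coherent b c α z

theorem inner_signalObservable (z : ℂ) (X : Set ℝ) (φ ψ : H) :
    ⟪φ, signalObservable b c ε₁ ε₂ z X ψ⟫_ℂ =
      ⟪outputState b c z φ, differenceObservable b c ε₁ ε₂ z X (outputState b c z ψ)⟫_ℂ := by
  simp only [signalObservable, outputState, ContinuousLinearMap.comp_apply,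
    ContinuousLinearMap.adjoint_inner_right]

/-- The total mass is ‖φ‖² because the squared norms ‖Kₚ ψ‖² add up to ‖ψ‖² and φ ↦ U(φ ⊗ |z⟩) is
isometric. -/
theorem isRepresentedBy_signalObservable (hε₁ : ε₁ ∈ Set.Ioc (0 : ℝ) 1)
    (hε₂ : ε₂ ∈ Set.Ioc (0 : ℝ) 1) (z : ℂ) :
    IsRepresentedBy (signalObservable b c ε₁ ε₂ z) fun φ =>
      outcomeMeasure (kraus b c ε₁ ε₂) (scaledDifference ε₁ ε₂ z) (outputState b c z φ) where
  measure_univ φ := by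
    have hK := isSubnormalized_kraus b c hε₁ hε₂
    rw [outcomeMeasure_apply hK _ _ MeasurableSet.univ, ← norm_outputState b c z φ,
      ← (hasSum_norm_sq_kraus b c hε₁ hε₂ _).tsum_eq]
    congr 1
    exact tsum_univ fun p => ‖kraus b c ε₁ ε₂ p (outputState b c z φ)‖ ^ 2
  inner_eq φ X hX := by
    have hK := isSubnormalized_kraus b c hε₁ hε₂
    rw [measureReal_def, outcomeMeasure_apply hK _ _ hX, ENNReal.toReal_ofReal
      (tsum_nonneg fun _ => by positivity), inner_signalObservable,
      inner_differenceObservable b c hε₁ hε₂]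

theorem norm_exp_ofReal_mul_I_le (x y : ℝ) : ‖Complex.exp (x * y * Complex.I)‖ ≤ 1 := by
  rw [← Complex.ofReal_mul, Complex.norm_exp_ofReal_mul_I]

/-- The operator `∫ exp(itx) dE(x)` for the signal observable `E`. -/
def signalCharOp (hε₁ : ε₁ ∈ Set.Ioc (0 : ℝ) 1) (hε₂ : ε₂ ∈ Set.Ioc (0 : ℝ) 1) (z : ℂ) (t : ℝ) :
    H →L[ℂ] H :=
  (outputState b c z).adjoint ∘L
    crossSum (isSubnormalized_kraus b c hε₁ hε₂) ((isSubnormalized_kraus b c hε₁ hε₂).smul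
      fun p => norm_exp_ofReal_mul_I_le t (scaledDifference ε₁ ε₂ z p)) ∘L outputState b c z

theorem norm_signalCharOp_le (hε₁ : ε₁ ∈ Set.Ioc (0 : ℝ) 1) (hε₂ : ε₂ ∈ Set.Ioc (0 : ℝ) 1)
    (z : ℂ) (t : ℝ) : ‖signalCharOp b c hε₁ hε₂ z t‖ ≤ 1 := by
  refine (ContinuousLinearMap.opNorm_comp_le _ _).trans ?_
  rw [LinearIsometryEquiv.norm_map]
  refine mul_le_one₀ (norm_outputState_le b c z) (norm_nonneg _) ?_
  exact (ContinuousLinearMap.opNorm_comp_le _ _).trans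
    (mul_le_one₀ (norm_crossSum_le _ _) (norm_nonneg _) (norm_outputState_le b c z))

theorem charFun_signal (hε₁ : ε₁ ∈ Set.Ioc (0 : ℝ) 1) (hε₂ : ε₂ ∈ Set.Ioc (0 : ℝ) 1)
    (z : ℂ) (t : ℝ) (φ : H) :
    charFun (outcomeMeasure (kraus b c ε₁ ε₂) (scaledDifference ε₁ ε₂ z) (outputState b c z φ)) t =
      ⟪φ, signalCharOp b c hε₁ hε₂ z t φ⟫_ℂ := by
  rw [signalCharOp, ContinuousLinearMap.comp_apply, ContinuousLinearMap.adjoint_inner_right]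
  exact charFun_outcomeMeasure _ _ _ _ _

/-- The outcome is linear in the two photon counts, so its phase has the form s^m u^n required by
the generating function. -/
theorem exp_scaledDifference (ε₁ ε₂ : ℝ) (z : ℂ) (t : ℝ) (p : ℕ × ℕ) :
    Complex.exp (t * scaledDifference ε₁ ε₂ z p * Complex.I) =
      Complex.exp (-(t / (√2 * ‖z‖ * ε₁)) * Complex.I) ^ p.1 *
      Complex.exp (t / (√2 * ‖z‖ * ε₂) * Complex.I) ^ p.2 := by
  rw [← Complex.exp_nat_mul, ← Complex.exp_nat_mul, ← Complex.exp_add, scaledDifference]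
  congr 1
  push_cast
  simp only [div_eq_mul_inv, mul_inv]
  ring

/-- The two output modes have amplitudes (β ∓ z)/√2, so each generating function contributes an
exponential. With s = u = 1 the exponents would add up to that of ⟪α, β⟫ by unitarity; only the
terms with s - 1 and u - 1 remain. -/
theorem inner_signalCharOp_coherent (hε₁ : ε₁ ∈ Set.Ioc (0 : ℝ) 1)
    (hε₂ : ε₂ ∈ Set.Ioc (0 : ℝ) 1) (z : ℂ) (t : ℝ) (α β : ℂ) :
    ⟪coherent b α, signalCharOp b c hε₁ hε₂ z t (coherent b β)⟫_ℂ =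
      ⟪coherent b α, coherent b β⟫_ℂ * Complex.exp (
        ε₁ * (Complex.exp (-(t / (√2 * ‖z‖ * ε₁)) * Complex.I) - 1) *
          (((starRingEnd ℂ) α - (starRingEnd ℂ) z) * (β - z) / 2) +
        ε₂ * (Complex.exp (t / (√2 * ‖z‖ * ε₂) * Complex.I) - 1) *
          (((starRingEnd ℂ) α + (starRingEnd ℂ) z) * (β + z) / 2)) := by
  rw [signalCharOp, ContinuousLinearMap.comp_apply, ContinuousLinearMap.adjoint_inner_right,
    ContinuousLinearMap.comp_apply, outputState_coherent, outputState_coherent]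
  refine (hasSum_inner_crossSum _ _ _ _).unique ?_
  refine hasSum_of_eq (hasSum_inner_kraus_coherent b c hε₁ hε₂
    (Complex.exp (-(t / (√2 * ‖z‖ * ε₁)) * Complex.I))
    (Complex.exp (t / (√2 * ‖z‖ * ε₂) * Complex.I)) ((α - z) / √2) ((α + z) / √2)
    ((β - z) / √2) ((β + z) / √2)) (fun p => ?_) ?_
  · rw [smul_apply, inner_smul_right, exp_scaledDifference]
  · rw [inner_coherent, ← Complex.exp_add, ← Complex.exp_add]
    congr 1
    have h2 : (√2 : ℂ) * (√2 : ℂ) = 2 := by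
      rw [← Complex.ofReal_mul, Real.mul_self_sqrt (by norm_num)]; simp
    have hn : ∀ z : ℂ, ((‖z‖ ^ 2 / 2 : ℝ) : ℂ) = z * (starRingEnd ℂ) z / 2 := by
      intro z; rw [Complex.mul_conj']; push_cast; rfl
    have hd : ∀ u v : ℂ, u / √2 * (v / √2) = u * v / 2 := by
      intro u v; rw [div_mul_div_comm, h2]
    simp only [hn, map_div₀, map_sub, map_add, Complex.conj_ofReal, hd]
    ring

end

/-! ### Gaussian integrals and coherent states in the position representation -/

/-- Completing the square in the real part, the exponential has modulus exp((Re z)²/2) exp(-(x - Re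
z)²/2). Composing `P` with X + Re z compensates the translation. -/
theorem integrable_poly_cexp_gauss (P : Polynomial ℝ) (z : ℂ) :
    Integrable fun x : ℝ => ((P.eval x : ℝ) : ℂ) * Complex.exp (z * x - x ^ 2 / 2) := by
  have h := ((integrable_poly_gauss (P.comp (Polynomial.X + Polynomial.C z.re))).comp_sub_right
    z.re).const_mul (Real.exp (z.re ^ 2 / 2))
  refine h.mono (by fun_prop) (ae_of_all _ fun x => le_of_eq ?_)
  rw [norm_mul, Complex.norm_real, Complex.norm_exp, norm_mul, norm_mul,
    Real.norm_of_nonneg (Real.exp_pos _).le, Real.norm_of_nonneg (Real.exp_pos _).le]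
  have e1 : (z * x - x ^ 2 / 2 : ℂ).re = z.re ^ 2 / 2 + -((x - z.re) ^ 2 / 2) := by
    have : (x ^ 2 / 2 : ℂ) = ((x ^ 2 / 2 : ℝ) : ℂ) := by push_cast; rfl
    rw [this]
    simp only [Complex.sub_re, Complex.mul_re, Complex.ofReal_re, Complex.ofReal_im]
    ring
  rw [e1, Real.exp_add]
  simp only [Polynomial.eval_comp, Polynomial.eval_add, Polynomial.eval_X, Polynomial.eval_C,
    sub_add_cancel]
  ring

/-- By Heₙ₊₁ = x Heₙ - Heₙ', the derivative of Heₙ(x) exp(zx - x²/2) is z times this function minus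
its successor. Its integral is zero, so each step multiplies the integral by z. -/
theorem integral_he_mul_cexp_gauss (n : ℕ) (z : ℂ) :
    ∫ x : ℝ, (((he n).eval x : ℝ) : ℂ) * Complex.exp (z * x - x ^ 2 / 2) =
      z ^ n * (√(2 * Real.pi) * Complex.exp (z ^ 2 / 2)) := by
  induction n with
  | zero =>
    have h := integral_cexp_quadratic (b := -(1 / 2)) (by norm_num) z 0
    have e : ∀ x : ℝ, (((he 0).eval x : ℝ) : ℂ) * Complex.exp (z * x - x ^ 2 / 2) =
        Complex.exp (-(1 / 2) * x ^ 2 + z * x + 0) := by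
      intro x
      rw [show he 0 = 1 by simp [he]]
      simp only [Polynomial.eval_one, Complex.ofReal_one, one_mul]
      congr 1; ring
    simp_rw [e]
    rw [h, pow_zero, one_mul, Real.sqrt_eq_rpow, Complex.ofReal_cpow (by positivity)]
    congr 2
    · push_cast; ring
    · push_cast; ring
    · ring
  | succ n ih =>
    have hd : ∀ x : ℝ, HasDerivAt
        (fun x : ℝ => (((he n).eval x : ℝ) : ℂ) * Complex.exp (z * x - x ^ 2 / 2))
        (z * ((((he n).eval x : ℝ) : ℂ) * Complex.exp (z * x - x ^ 2 / 2)) -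
          (((he (n + 1)).eval x : ℝ) : ℂ) * Complex.exp (z * x - x ^ 2 / 2)) x := by
      intro x
      have h1 := ((he n).hasDerivAt x).ofReal_comp
      have h2 : HasDerivAt (fun x : ℝ => Complex.exp (z * x - x ^ 2 / 2))
          (Complex.exp (z * x - x ^ 2 / 2) * (z - x)) x := by
        have h3 : HasDerivAt (fun w : ℂ => Complex.exp (z * w - w ^ 2 / 2))
            (Complex.exp (z * x - x ^ 2 / 2) * (z - x)) (x : ℂ) := by
          have h4 : HasDerivAt (fun w : ℂ => z * w - w ^ 2 / 2) (z - x) (x : ℂ) := by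
            refine (((hasDerivAt_id (x : ℂ)).const_mul z).sub
              ((hasDerivAt_pow 2 (x : ℂ)).div_const 2)).congr_deriv ?_
            simp
          exact h4.cexp
        exact h3.comp_ofReal
      refine (h1.mul h2).congr_deriv ?_
      simp only [he_succ, Polynomial.eval_sub, Polynomial.eval_mul, Polynomial.eval_X]
      push_cast
      ring
    have h0 := integral_eq_zero_of_hasDerivAt_of_integrable hd
      (((integrable_poly_cexp_gauss _ _).const_mul z).sub (integrable_poly_cexp_gauss _ _))
      (integrable_poly_cexp_gauss _ _)
    rw [integral_sub ((integrable_poly_cexp_gauss _ _).const_mul z)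
      (integrable_poly_cexp_gauss _ _), sub_eq_zero, integral_const_mul, ih] at h0
    rw [← h0]
    ring

/-- The coherent state in the position representation. -/
def coherentFun (z : ℂ) (x : ℝ) : ℂ :=
  ((√(√Real.pi))⁻¹ : ℝ) * Complex.exp (-x ^ 2 / 2 + √2 * z * x - z ^ 2 / 2 - (‖z‖ ^ 2 / 2 : ℝ))

theorem ofReal_sqrt_two_mul_self : (√2 : ℂ) * (√2 : ℂ) = 2 := by
  rw [← Complex.ofReal_mul, Real.mul_self_sqrt (by norm_num)]; simp

/-- A single Gaussian integral. The factor exp(itx) adds it to the linear coefficient √2(ᾱ + β), and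
the square of the sum yields both -t²/4 and the cross term. -/
theorem integral_conj_coherentFun_mul (t : ℝ) (α β : ℂ) :
    ∫ x : ℝ, (starRingEnd ℂ) (coherentFun α x) * (Complex.exp (t * x * Complex.I) *
        coherentFun β x) =
      Complex.exp (-(‖α‖ ^ 2 / 2 : ℝ) - (‖β‖ ^ 2 / 2 : ℝ) + (starRingEnd ℂ) α * β) *
      Complex.exp (-(t ^ 2 / 4) + t / √2 * ((starRingEnd ℂ) α + β) * Complex.I) := by
  have hpi : (0 : ℝ) < √Real.pi := Real.sqrt_pos.2 Real.pi_pos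
  have e : ∀ x : ℝ, (starRingEnd ℂ) (coherentFun α x) * (Complex.exp (t * x * Complex.I) *
        coherentFun β x) = ((√Real.pi)⁻¹ : ℝ) * Complex.exp (-1 * x ^ 2 +
        (√2 * ((starRingEnd ℂ) α + β) + t * Complex.I) * x +
        (-(((starRingEnd ℂ) α) ^ 2 + β ^ 2) / 2 - (‖α‖ ^ 2 / 2 : ℝ) - (‖β‖ ^ 2 / 2 : ℝ))) := by
    intro x
    have h1 : ((√(√Real.pi))⁻¹ : ℝ) * ((√(√Real.pi))⁻¹ : ℝ) = (√Real.pi)⁻¹ := by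
      rw [← mul_inv, Real.mul_self_sqrt hpi.le]
    rw [coherentFun, coherentFun, ← h1, map_mul, Complex.conj_ofReal, ← Complex.exp_conj]
    have h2 : ∀ a u v w : ℂ, a * Complex.exp u * (Complex.exp v * (a * Complex.exp w)) =
        a * a * Complex.exp (u + v + w) := by
      intro a u v w; rw [Complex.exp_add, Complex.exp_add]; ring
    rw [h2, Complex.ofReal_mul]
    congr 2
    simp only [map_sub, map_add, map_mul, map_div₀, map_neg, map_pow, Complex.conj_ofReal,
      map_ofNat]
    ring
  simp_rw [e]
  rw [integral_const_mul, integral_cexp_quadratic (by norm_num), neg_neg, div_one, ← mul_assoc,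
    ← Complex.exp_add]
  have h1 : (((√Real.pi)⁻¹ : ℝ) : ℂ) * (Real.pi : ℂ) ^ (1 / 2 : ℂ) = 1 := by
    have : (Real.pi : ℂ) ^ (1 / 2 : ℂ) = ((√Real.pi : ℝ) : ℂ) := by
      rw [Real.sqrt_eq_rpow, Complex.ofReal_cpow Real.pi_pos.le]
      push_cast; rfl
    rw [this, ← Complex.ofReal_mul, inv_mul_cancel₀ hpi.ne', Complex.ofReal_one]
  rw [h1, one_mul]
  congr 1
  have h2 := ofReal_sqrt_two_mul_self
  have h3 : (√2 : ℂ) ≠ 0 := fun h => by simp [h] at h2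
  have h4 : (t : ℂ) / √2 = t * √2 / 2 := by rw [div_eq_div_iff h3 two_ne_zero, ← h2]; ring
  have h5 : (√2 * ((starRingEnd ℂ) α + β) + t * Complex.I : ℂ) ^ 2 =
      2 * ((starRingEnd ℂ) α + β) ^ 2 + 2 * (t * √2 * ((starRingEnd ℂ) α + β) * Complex.I) -
        t ^ 2 := by
    have := Complex.I_mul_I
    linear_combination ((starRingEnd ℂ) α + β) ^ 2 * h2 + (t : ℂ) ^ 2 * this
  rw [h4, h5]
  ring

theorem continuous_coherentFun (z : ℂ) : Continuous (coherentFun z) := by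
  unfold coherentFun
  fun_prop

theorem integral_hermiteFun_mul_coherentFun (n : ℕ) (z : ℂ) :
    ∫ x : ℝ, (hermiteFun n x : ℂ) * coherentFun z x =
      (Real.exp (-‖z‖ ^ 2 / 2) : ℂ) * (z ^ n / (√(n.factorial : ℝ) : ℂ)) := by
  have hpi : (0 : ℝ) < √Real.pi := Real.sqrt_pos.2 Real.pi_pos
  have e : ∀ x : ℝ, (hermiteFun n x : ℂ) * coherentFun z x =
      (((√(√Real.pi * n.factorial))⁻¹ * (√(√Real.pi))⁻¹ : ℝ) *
        Complex.exp (-z ^ 2 / 2 - (‖z‖ ^ 2 / 2 : ℝ))) *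
      (fun y : ℝ => (((he n).eval y : ℝ) : ℂ) * Complex.exp (z * y - y ^ 2 / 2)) (√2 * x) := by
    intro x
    rw [hermiteFun_eq, coherentFun]
    have h1 : Complex.exp (-x ^ 2 / 2 + √2 * z * x - z ^ 2 / 2 - (‖z‖ ^ 2 / 2 : ℝ)) *
        (Real.exp (-x ^ 2 / 2) : ℂ) = Complex.exp (-z ^ 2 / 2 - (‖z‖ ^ 2 / 2 : ℝ)) *
        Complex.exp (z * (√2 * x : ℝ) - (√2 * x : ℝ) ^ 2 / 2) := by
      rw [Complex.ofReal_exp, ← Complex.exp_add, ← Complex.exp_add]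
      congr 1
      push_cast
      linear_combination ((x : ℂ) ^ 2 / 2) * ofReal_sqrt_two_mul_self
    push_cast at h1 ⊢
    linear_combination ((√(√Real.pi * n.factorial) : ℂ)⁻¹ * (√(√Real.pi) : ℂ)⁻¹ *
      (((he n).eval (√2 * x) : ℝ) : ℂ)) * h1
  simp_rw [e]
  rw [integral_const_mul, Measure.integral_comp_mul_left
    (fun y : ℝ => (((he n).eval y : ℝ) : ℂ) * Complex.exp (z * y - y ^ 2 / 2)),
    integral_he_mul_cexp_gauss]
  have h1 : Complex.exp (-z ^ 2 / 2 - (‖z‖ ^ 2 / 2 : ℝ)) * Complex.exp (z ^ 2 / 2) =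
      (Real.exp (-‖z‖ ^ 2 / 2) : ℂ) := by
    rw [Complex.ofReal_exp, ← Complex.exp_add]
    congr 1; push_cast; ring
  have h2 : (√(√Real.pi * n.factorial))⁻¹ * (√(√Real.pi))⁻¹ * (√2)⁻¹ * √(2 * Real.pi) =
      (√(n.factorial : ℝ))⁻¹ := by
    rw [Real.sqrt_mul hpi.le, Real.sqrt_mul (by norm_num : (0 : ℝ) ≤ 2)]
    have h3 : √(√Real.pi) * √(√Real.pi) = √Real.pi := Real.mul_self_sqrt hpi.le
    have h4 : (0 : ℝ) < √(√Real.pi) := Real.sqrt_pos.2 hpi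
    have h5 : (0 : ℝ) < √(n.factorial : ℝ) := Real.sqrt_pos.2 (by positivity)
    field_simp
    rw [sq, h3]
  have h2' := congrArg (fun r : ℝ => (r : ℂ)) h2
  rw [abs_of_pos (by positivity), Complex.real_smul, ← h1]
  push_cast at h2' ⊢
  linear_combination (Complex.exp (-z ^ 2 / 2 - (‖z‖ : ℂ) ^ 2 / 2) * Complex.exp (z ^ 2 / 2) *
    z ^ n) * h2'

theorem memLp_coherentFun (z : ℂ) : MemLp (coherentFun z) 2 volume := by
  have hc := continuous_coherentFun z
  rw [memLp_two_iff_integrable_sq_norm hc.aestronglyMeasurable]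
  -- Otherwise the integral of |f|² would have the default value 0, whereas the preceding formula
  -- with t = 0 makes it an exponential, which is nonzero.
  by_contra hI
  have h := integral_conj_coherentFun_mul 0 z z
  have e : (fun x : ℝ => (starRingEnd ℂ) (coherentFun z x) *
      (Complex.exp ((0 : ℝ) * x * Complex.I) * coherentFun z x)) =
      fun x => ((‖coherentFun z x‖ ^ 2 : ℝ) : ℂ) := by
    ext x
    simp only [Complex.ofReal_zero, zero_mul, Complex.exp_zero, one_mul]
    rw [mul_comm, Complex.mul_conj']
    push_cast
    rfl
  rw [e, integral_complex_ofReal, integral_undef hI] at h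
  simp at h
  exact Complex.exp_ne_zero _ h.symm

/-! ### The rotated quadrature and its distribution -/

section
variable {H : Type*} [NormedAddCommGroup H] [InnerProductSpace ℂ H] (b : HilbertBasis ℕ ℂ H)

/-- Both sides have the same Hermite coefficients, by `integral_hermiteFun_mul_coherentFun`. -/
theorem positionRep_coherent (z : ℂ) : positionRep b (coherent b z) = (memLp_coherentFun z).toLp := by
  rw [positionRep, LinearIsometryEquiv.trans_apply, LinearIsometryEquiv.symm_apply_eq]
  ext n
  rw [repr_coherent, hermiteBasis.repr_apply_apply, ← integral_hermiteFun_mul_coherentFun]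
  have : hermiteBasis n = (memLp_hermiteFun n).toLp := by simp [hermiteBasis]
  rw [this, inner_hermite]
  apply integral_congr_ae
  filter_upwards [(memLp_coherentFun z).coeFn_toLp] with x hx
  rw [hx]

theorem norm_phase_le (t : ℝ) (n : ℕ) : ‖Complex.exp (Complex.I * t * n)‖ ≤ 1 := by
  rw [show Complex.I * t * n = ((t * n : ℝ) : ℂ) * Complex.I by push_cast; ring,
    Complex.norm_exp_ofReal_mul_I]

theorem phaseShift_coherent (θ : ℝ) (z : ℂ) :
    phaseShift b θ (coherent b z) = coherent b (Complex.exp (Complex.I * θ) * z) := by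
  apply b.repr.injective
  ext n
  rw [phaseShift, repr_diagOp b (norm_phase_le θ), repr_coherent, repr_coherent, norm_mul,
    mul_comm Complex.I, Complex.norm_exp_ofReal_mul_I, one_mul, mul_pow, ← Complex.exp_nat_mul]
  ring_nf

theorem phaseShift_phaseShift_neg (θ : ℝ) (φ : H) :
    phaseShift b θ (phaseShift b (-θ) φ) = φ := by
  apply b.repr.injective
  ext n
  rw [phaseShift, repr_diagOp b (norm_phase_le θ), phaseShift, repr_diagOp b (norm_phase_le (-θ)),
    ← mul_assoc, ← Complex.exp_add]
  push_cast
  ring_nf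
  simp

/-- The bounded function `f` of the rotated quadrature operator. -/
def rotatedPositionOp (θ : ℝ) (f : ℝ → ℂ) : H →L[ℂ] H :=
  phaseShift b θ ∘L ((positionRep b).symm : Lp ℂ 2 (volume : Measure ℝ) →L[ℂ] H) ∘L
    mulOp f ∘L (positionRep b : H →L[ℂ] Lp ℂ 2 (volume : Measure ℝ)) ∘L phaseShift b (-θ)

theorem inner_rotatedPositionOp (θ : ℝ) (f : ℝ → ℂ) (φ ψ : H) :
    ⟪φ, rotatedPositionOp b θ f ψ⟫_ℂ =
      ⟪positionRep b (phaseShift b (-θ) φ), mulOp f (positionRep b (phaseShift b (-θ) ψ))⟫_ℂ := by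
  have e : rotatedPositionOp b θ f ψ =
    phaseShift b θ ((positionRep b).symm (mulOp f (positionRep b (phaseShift b (-θ) ψ)))) := rfl
  rw [e, inner_phaseShift, ← (positionRep b).inner_map_map, (positionRep b).apply_symm_apply]

/-- The phase shift only rotates the amplitudes of coherent states. Integrability is recorded so
that the cosine and sine integrals can later be added. -/
theorem inner_rotatedPositionOp_coherent (θ : ℝ) {f : ℝ → ℂ} (hf : MemLp f ∞ volume) (α β : ℂ) :
    Integrable (fun x => (starRingEnd ℂ) (coherentFun (Complex.exp (-(Complex.I * θ)) * α) x) *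
      (f x * coherentFun (Complex.exp (-(Complex.I * θ)) * β) x)) ∧
    ⟪coherent b α, rotatedPositionOp b θ f (coherent b β)⟫_ℂ =
      ∫ x, (starRingEnd ℂ) (coherentFun (Complex.exp (-(Complex.I * θ)) * α) x) *
        (f x * coherentFun (Complex.exp (-(Complex.I * θ)) * β) x) := by
  have e : Complex.I * ((-θ : ℝ) : ℂ) = -(Complex.I * θ) := by push_cast; ring
  rw [inner_rotatedPositionOp, phaseShift_coherent, phaseShift_coherent, e, positionRep_coherent,
    positionRep_coherent, L2.inner_def]
  set g := (memLp_coherentFun (Complex.exp (-(Complex.I * θ)) * α)).toLp with hg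
  set g' := (memLp_coherentFun (Complex.exp (-(Complex.I * θ)) * β)).toLp with hg'
  have hae : (fun x => ⟪g x, mulOp f g' x⟫_ℂ) =ᵐ[volume] fun x =>
      (starRingEnd ℂ) (coherentFun (Complex.exp (-(Complex.I * θ)) * α) x) *
        (f x * coherentFun (Complex.exp (-(Complex.I * θ)) * β) x) := by
    filter_upwards [coeFn_mulOp hf g',
      (memLp_coherentFun (Complex.exp (-(Complex.I * θ)) * α)).coeFn_toLp,
      (memLp_coherentFun (Complex.exp (-(Complex.I * θ)) * β)).coeFn_toLp] with x h1 h2 h3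
    rw [h1, h2, h3, RCLike.inner_apply, mul_comm]
  exact ⟨(L2.integrable_inner (𝕜 := ℂ) g (mulOp f g')).congr hae, integral_congr_ae hae⟩

/-- The operator `exp(itQ_θ)`, where `Q_θ` is the rotated quadrature operator. -/
def rotatedWeyl (θ t : ℝ) : H →L[ℂ] H :=
  -- Weak integrals are defined for real functions, so exp(itx) is split into cosine and sine.
  rotatedPositionOp b θ (fun x => (Real.cos (t * x) : ℂ)) +
    Complex.I • rotatedPositionOp b θ (fun x => (Real.sin (t * x) : ℂ))

theorem inner_rotatedWeyl_coherent (θ t : ℝ) (α β : ℂ) :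
    ⟪coherent b α, rotatedWeyl b θ t (coherent b β)⟫_ℂ =
      ⟪coherent b α, coherent b β⟫_ℂ * Complex.exp (-(t ^ 2 / 4) + t / √2 *
        ((starRingEnd ℂ) α * Complex.exp (Complex.I * θ) +
          β * Complex.exp (-(Complex.I * θ))) * Complex.I) := by
  have hc : MemLp (fun x : ℝ => (Real.cos (t * x) : ℂ)) ∞ volume :=
    memLp_top_of_bound (by fun_prop) 1 (ae_of_all _ fun x => by
      rw [Complex.norm_real]; exact Real.abs_cos_le_one _)
  have hs : MemLp (fun x : ℝ => (Real.sin (t * x) : ℂ)) ∞ volume :=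
    memLp_top_of_bound (by fun_prop) 1 (ae_of_all _ fun x => by
      rw [Complex.norm_real]; exact Real.abs_sin_le_one _)
  obtain ⟨ic, ec⟩ := inner_rotatedPositionOp_coherent b θ hc α β
  obtain ⟨is, es⟩ := inner_rotatedPositionOp_coherent b θ hs α β
  have hn : ∀ w : ℂ, ‖Complex.exp (-(Complex.I * θ)) * w‖ = ‖w‖ := fun w => by
    rw [norm_mul, show -(Complex.I * θ) = ((-θ : ℝ) : ℂ) * Complex.I by push_cast; ring,
      Complex.norm_exp_ofReal_mul_I, one_mul]
  have hcj : (starRingEnd ℂ) (Complex.exp (-(Complex.I * θ))) = Complex.exp (Complex.I * θ) := by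
    rw [← Complex.exp_conj]; simp
  have h1 : Complex.exp (Complex.I * θ) * Complex.exp (-(Complex.I * θ)) = 1 := by
    rw [← Complex.exp_add, add_neg_cancel, Complex.exp_zero]
  rw [rotatedWeyl, add_apply, smul_apply, inner_add_right, inner_smul_right, ec, es,
    ← integral_const_mul, ← integral_add ic (is.const_mul _), inner_coherent]
  convert integral_conj_coherentFun_mul t (Complex.exp (-(Complex.I * θ)) * α)
    (Complex.exp (-(Complex.I * θ)) * β) using 1
  · congr 1
    funext x
    rw [Complex.exp_mul_I]
    push_cast
    ring
  · rw [hn, hn, map_mul, hcj]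
    congr 2
    · linear_combination -((starRingEnd ℂ) α * β) * h1
    · ring

/-- The distribution of the rotated quadrature observable in the state `φ`. -/
def quadratureMeasure (θ : ℝ) (φ : H) : Measure ℝ :=
  -- The integrand is immaterial: only the measure X ↦ ⟪φ, Q_θ(X) φ⟫ is extracted.
  (isWeakIntegral_rotatedQuadrature b θ (f := fun _ => 0) measurable_const (C := 0)
    (by simp) φ).choose

theorem isFiniteMeasure_quadratureMeasure (θ : ℝ) (φ : H) :
    IsFiniteMeasure (quadratureMeasure b θ φ) :=
  (isWeakIntegral_rotatedQuadrature b θ (f := fun _ => 0) measurable_const (C := 0)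
    (by simp) φ).choose_spec.1

theorem quadratureMeasure_real (θ : ℝ) (φ : H) {X : Set ℝ} (hX : MeasurableSet X) :
    (((quadratureMeasure b θ φ).real X : ℝ) : ℂ) = ⟪φ, rotatedQuadrature b θ X φ⟫_ℂ :=
  (isWeakIntegral_rotatedQuadrature b θ (f := fun _ => 0) measurable_const (C := 0)
    (by simp) φ).choose_spec.2.1 X hX

/-- A weak integral supplies some representing measure for each integrand; its values on Borel sets
determine it, so all of them are the same measure. -/
theorem inner_eq_integral_quadratureMeasure {θ : ℝ} {f : ℝ → ℝ} {A : H →L[ℂ] H}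
    (hA : IsWeakIntegral (rotatedQuadrature b θ) f A) (φ : H) :
    ⟪φ, A φ⟫_ℂ = ((∫ x, f x ∂quadratureMeasure b θ φ : ℝ) : ℂ) := by
  obtain ⟨ν, h1, h2, h3⟩ := hA φ
  have := isFiniteMeasure_quadratureMeasure b θ φ
  have hν : ν = quadratureMeasure b θ φ := Measure.ext fun X hX => by
    have := (h2 X hX).trans (quadratureMeasure_real b θ φ hX).symm
    exact (measureReal_eq_measureReal_iff).1 (Complex.ofReal_injective this)
  rw [h3, hν]

theorem charFun_quadratureMeasure (θ : ℝ) (φ : H) (t : ℝ) :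
    charFun (quadratureMeasure b θ φ) t = ⟪φ, rotatedWeyl b θ t φ⟫_ℂ := by
  have := isFiniteMeasure_quadratureMeasure b θ φ
  have hc := inner_eq_integral_quadratureMeasure b (isWeakIntegral_rotatedQuadrature b θ
    (f := fun x => Real.cos (t * x)) (by fun_prop) (C := 1) fun x => Real.abs_cos_le_one _) φ
  have hs := inner_eq_integral_quadratureMeasure b (isWeakIntegral_rotatedQuadrature b θ
    (f := fun x => Real.sin (t * x)) (by fun_prop) (C := 1) fun x => Real.abs_sin_le_one _) φ
  have hic : Integrable (fun x : ℝ => (Real.cos (t * x) : ℂ)) (quadratureMeasure b θ φ) :=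
    Integrable.of_bound (by fun_prop) 1 (ae_of_all _ fun x => by
      rw [Complex.norm_real]; exact Real.abs_cos_le_one _)
  have his : Integrable (fun x : ℝ => (Real.sin (t * x) : ℂ)) (quadratureMeasure b θ φ) :=
    Integrable.of_bound (by fun_prop) 1 (ae_of_all _ fun x => by
      rw [Complex.norm_real]; exact Real.abs_sin_le_one _)
  rw [rotatedWeyl, add_apply, smul_apply, inner_add_right, inner_smul_right, rotatedPositionOp,
    rotatedPositionOp, hc, hs, ← integral_complex_ofReal, ← integral_complex_ofReal,
    ← integral_const_mul, ← integral_add hic (his.const_mul _), charFun_apply_real]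
  congr 1
  funext x
  rw [Complex.exp_mul_I]
  push_cast
  ring

theorem rotatedQuadrature_univ (θ : ℝ) (φ : H) : rotatedQuadrature b θ Set.univ φ = φ := by
  have h : ∀ g, mulOp (Set.univ.indicator fun _ => (1 : ℂ)) g = g := fun g => by
    apply Lp.ext
    filter_upwards [coeFn_mulOp (memLp_indicator_one MeasurableSet.univ) g] with x hx
    rw [hx]
    simp
  have e : rotatedQuadrature b θ Set.univ φ = phaseShift b θ ((positionRep b).symm
    (mulOp (Set.univ.indicator fun _ => (1 : ℂ)) (positionRep b (phaseShift b (-θ) φ)))) := rfl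
  rw [e, h, LinearIsometryEquiv.symm_apply_apply, phaseShift_phaseShift_neg]

theorem quadratureMeasure_univ (θ : ℝ) (φ : H) :
    quadratureMeasure b θ φ Set.univ = ENNReal.ofReal (‖φ‖ ^ 2) := by
  have := isFiniteMeasure_quadratureMeasure b θ φ
  have h := quadratureMeasure_real b θ φ MeasurableSet.univ
  rw [rotatedQuadrature_univ, inner_self_eq_norm_sq_to_K] at h
  have h' : (quadratureMeasure b θ φ).real Set.univ = ‖φ‖ ^ 2 := by
    rw [← RCLike.ofReal_pow] at h
    exact Complex.ofReal_injective h
  rw [← h', measureReal_def, ENNReal.ofReal_toReal (measure_ne_top _ _)]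

/-- By Tonelli, (μ * ν)(X) = ∫ μ(X - x) dν(x) for the distribution ν of Q_θ, so smearing the
observable means convolving its distributions. -/
theorem isRepresentedBy_smear (θ : ℝ) (μ : Measure ℝ) [IsProbabilityMeasure μ] :
    IsRepresentedBy (smear μ (rotatedQuadrature b θ)) fun φ => μ.conv (quadratureMeasure b θ φ) where
  measure_univ φ := by
    have := isFiniteMeasure_quadratureMeasure b θ φ
    rw [Measure.conv, Measure.map_apply (by fun_prop) MeasurableSet.univ, Set.preimage_univ,
      ← Set.univ_prod_univ, Measure.prod_prod, measure_univ, one_mul, quadratureMeasure_univ]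
  inner_eq φ X hX := by
    have := isFiniteMeasure_quadratureMeasure b θ φ
    rw [inner_eq_integral_quadratureMeasure b (smear_rotatedQuadrature b θ μ hX)]
    congr 1
    have hm : MeasurableSet ((fun p : ℝ × ℝ => p.1 + p.2) ⁻¹' X) :=
      (measurable_fst.add measurable_snd) hX
    rw [measureReal_def, Measure.conv, Measure.map_apply (by fun_prop) hX,
      Measure.prod_apply_symm hm]
    simp only [measureReal_def]
    rw [integral_toReal]
    · rfl
    · exact (measurable_measure_prodMk_right hm).aemeasurable
    · exact ae_of_all _ fun x => measure_lt_top _ _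

end

/-! ### The smearing measure as a Gaussian -/

/-- The variance of the measure `μ_{ε₁,ε₂}`. -/
def smearingVariance (ε₁ ε₂ : ℝ) : ℝ := (ε₁ - 2 * ε₁ * ε₂ + ε₂) / (4 * ε₁ * ε₂)

theorem smearingVariance_nonneg {ε₁ ε₂ : ℝ} (hε₁ : ε₁ ∈ Set.Ioc (0 : ℝ) 1)
    (hε₂ : ε₂ ∈ Set.Ioc (0 : ℝ) 1) : 0 ≤ smearingVariance ε₁ ε₂ := by
  obtain ⟨h1, h1'⟩ := hε₁
  obtain ⟨h2, h2'⟩ := hε₂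
  refine div_nonneg ?_ (by positivity)
  nlinarith

/-- A Gaussian of variance 0 is a Dirac measure, so ideal detectors need no separate treatment
afterwards. -/
theorem smearingMeasure_eq_gaussianReal {ε₁ ε₂ : ℝ} (hε₁ : ε₁ ∈ Set.Ioc (0 : ℝ) 1)
    (hε₂ : ε₂ ∈ Set.Ioc (0 : ℝ) 1) : smearingMeasure ε₁ ε₂ =
      ProbabilityTheory.gaussianReal 0 (smearingVariance ε₁ ε₂).toNNReal := by
  have hv := smearingVariance_nonneg hε₁ hε₂
  obtain ⟨h1, h1'⟩ := hε₁
  obtain ⟨h2, h2'⟩ := hε₂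
  by_cases h : ε₁ = 1 ∧ ε₂ = 1
  · have h0 : smearingVariance ε₁ ε₂ = 0 := by rw [h.1, h.2, smearingVariance]; norm_num
    rw [smearingMeasure, if_pos h, h0, Real.toNNReal_zero, ProbabilityTheory.gaussianReal_zero_var]
  · have hD : 0 < ε₁ - 2 * ε₁ * ε₂ + ε₂ := by
      rcases h1'.lt_or_eq with h3 | h3
      · nlinarith
      · have h4 : ε₂ < 1 := lt_of_le_of_ne h2' fun h4 => h ⟨h3, h4⟩
        rw [h3]; linarith
    have hv' : 0 < smearingVariance ε₁ ε₂ := div_pos hD (by positivity)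
    rw [smearingMeasure, if_neg h, ProbabilityTheory.gaussianReal_of_var_ne_zero]
    · congr 1
      funext x
      rw [ProbabilityTheory.gaussianPDF, ProbabilityTheory.gaussianPDFReal, smearingDensity,
        Real.coe_toNNReal _ hv, ← Real.sqrt_inv]
      have hpi := Real.pi_pos
      congr 3
      · rw [smearingVariance]; field_simp; ring
      · rw [smearingVariance, sub_zero]; field_simp; ring
    · exact (Real.toNNReal_pos.2 hv').ne'

theorem charFun_smearingMeasure {ε₁ ε₂ : ℝ} (hε₁ : ε₁ ∈ Set.Ioc (0 : ℝ) 1)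
    (hε₂ : ε₂ ∈ Set.Ioc (0 : ℝ) 1) (t : ℝ) : charFun (smearingMeasure ε₁ ε₂) t =
      Complex.exp (-(smearingVariance ε₁ ε₂ * t ^ 2 / 2)) := by
  rw [smearingMeasure_eq_gaussianReal hε₁ hε₂, ProbabilityTheory.charFun_gaussianReal,
    Real.coe_toNNReal _ (smearingVariance_nonneg hε₁ hε₂)]
  simp

/-! ### Asymptotics for a strong local oscillator -/

/-- Second-order Taylor expansion: exp(x) - 1 - x - x²/2 = o(x²) at x = a/r. -/
theorem tendsto_sq_mul_exp_div_sub {r : ℕ → ℝ} (hr : Tendsto r atTop atTop) (a : ℂ) :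
    Tendsto (fun k => (r k : ℂ) ^ 2 * (Complex.exp (a / r k) - 1 - a / r k)) atTop
      (𝓝 (a ^ 2 / 2)) := by
  have hinv : Tendsto (fun k => ((r k : ℂ))⁻¹) atTop (𝓝 0) := by
    have h := (Complex.continuous_ofReal.tendsto 0).comp (tendsto_inv_atTop_zero.comp hr)
    simpa [Function.comp_def] using h
  have hx : Tendsto (fun k => a / (r k : ℂ)) atTop (𝓝 0) := by
    simpa [div_eq_mul_inv] using hinv.const_mul a
  have h1 := (Complex.exp_sub_sum_range_succ_isLittleO_pow 2).comp_tendsto hx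
  have h2 : (fun k => (a / (r k : ℂ)) ^ 2) =O[atTop] fun k => ((r k : ℂ))⁻¹ ^ 2 := by
    simp_rw [div_eq_mul_inv, mul_pow]
    exact Asymptotics.isBigO_const_mul_self _ _ _
  have h3 := (h1.trans_isBigO h2).tendsto_div_nhds_zero
  have h4 := h3.add_const (a ^ 2 / 2)
  rw [zero_add] at h4
  refine h4.congr' ?_
  filter_upwards [hr.eventually_gt_atTop 0] with k hk
  have hk' : (r k : ℂ) ≠ 0 := by exact_mod_cast hk.ne'
  simp only [Function.comp_apply, Finset.sum_range_succ, Finset.sum_range_zero, pow_zero,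
    Nat.factorial_zero, Nat.cast_one, Nat.factorial_one, Nat.factorial_two, Nat.cast_ofNat]
  field_simp
  ring

theorem tendsto_mul_exp_div_sub_one {r : ℕ → ℝ} (hr : Tendsto r atTop atTop) (a : ℂ) :
    Tendsto (fun k => (r k : ℂ) * (Complex.exp (a / r k) - 1)) atTop (𝓝 a) := by
  have hinv : Tendsto (fun k => ((r k : ℂ))⁻¹) atTop (𝓝 0) := by
    have h := (Complex.continuous_ofReal.tendsto 0).comp (tendsto_inv_atTop_zero.comp hr)
    simpa [Function.comp_def] using h
  have h := ((tendsto_sq_mul_exp_div_sub hr a).mul hinv).add_const a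
  rw [mul_zero, zero_add] at h
  refine h.congr' ?_
  filter_upwards [hr.eventually_gt_atTop 0] with k hk
  have hk' : (r k : ℂ) ≠ 0 := by exact_mod_cast hk.ne'
  field_simp
  ring

/-- Expand (u ∓ rw')(v ∓ rw) = uv ∓ r(uw + vw') + r². The uv part tends to 0, the cross terms need
the first-order expansion of exp, and the r² part the second-order one. Its divergent contribution
r(e₁a₁ + e₂a₂)/2 is zero by `ha`. -/
theorem tendsto_signal_exponent {r : ℕ → ℝ} (hr : Tendsto r atTop atTop) {e₁ e₂ a₁ a₂ : ℂ}
    (ha : e₁ * a₁ + e₂ * a₂ = 0) (u v w w' : ℂ) (hw : w * w' = 1) :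
    Tendsto (fun k => e₁ * (Complex.exp (a₁ / r k) - 1) * ((u - r k * w') * (v - r k * w) / 2) +
      e₂ * (Complex.exp (a₂ / r k) - 1) * ((u + r k * w') * (v + r k * w) / 2)) atTop
      (𝓝 ((e₁ * a₁ ^ 2 + e₂ * a₂ ^ 2) / 4 + e₂ * a₂ * (u * w + v * w'))) := by
  have hinv : Tendsto (fun k => ((r k : ℂ))⁻¹) atTop (𝓝 0) := by
    have h := (Complex.continuous_ofReal.tendsto 0).comp (tendsto_inv_atTop_zero.comp hr)
    simpa [Function.comp_def] using h
  have h1 := tendsto_mul_exp_div_sub_one hr a₁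
  have h2 := tendsto_mul_exp_div_sub_one hr a₂
  have q1 := tendsto_sq_mul_exp_div_sub hr a₁
  have q2 := tendsto_sq_mul_exp_div_sub hr a₂
  -- The summands correspond to the powers r⁰, r¹ and r² of the expansion; the linear Taylor terms
  -- subtracted in the last one cost nothing because of `ha`.
  have h := ((((h1.const_mul e₁).add (h2.const_mul e₂)).mul hinv).mul_const (u * v / 2)).add
    ((((h2.const_mul e₂).sub (h1.const_mul e₁)).mul_const ((u * w + v * w') / 2)).add
    (((q1.const_mul e₁).add (q2.const_mul e₂)).mul_const (1 / 2)))
  have hl : (e₁ * a₁ + e₂ * a₂) * 0 * (u * v / 2) + ((e₂ * a₂ - e₁ * a₁) * ((u * w + v * w') / 2) +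
      (e₁ * (a₁ ^ 2 / 2) + e₂ * (a₂ ^ 2 / 2)) * (1 / 2)) =
      (e₁ * a₁ ^ 2 + e₂ * a₂ ^ 2) / 4 + e₂ * a₂ * (u * w + v * w') := by
    linear_combination -((u * w + v * w') / 2) * ha
  rw [hl] at h
  refine h.congr' ?_
  filter_upwards [hr.eventually_gt_atTop 0] with k hk
  have hk' : (r k : ℂ) ≠ 0 := by exact_mod_cast hk.ne'
  generalize hA : Complex.exp (a₁ / r k) = A
  generalize hB : Complex.exp (a₂ / r k) = B
  have e1 : ∀ y x : ℂ, (r k : ℂ) ^ 2 * (y - x / r k) = (r k : ℂ) ^ 2 * y - r k * x :=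
    fun y x => by field_simp
  have e2 : (r k : ℂ) * (r k : ℂ)⁻¹ = 1 := mul_inv_cancel₀ hk'
  rw [e1, e1]
  linear_combination ((e₁ * (A - 1) + e₂ * (B - 1)) * (u * v / 2)) * e2 -
    ((r k : ℂ) / 2) * ha - (e₁ * (A - 1) + e₂ * (B - 1)) * (r k : ℂ) ^ 2 / 2 * hw

end
end Homodyne

/-! ### Proof of the proposition -/

theorem mainTheorem1 {H K : Type*}
    [NormedAddCommGroup H] [InnerProductSpace ℂ H] [CompleteSpace H]
    [NormedAddCommGroup K] [InnerProductSpace ℂ K] [CompleteSpace K]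
    (b : HilbertBasis ℕ ℂ H) (c : HilbertBasis ℕ ℂ K)
    (ε₁ ε₂ : ℝ) (hε₁ : ε₁ ∈ Set.Ioc (0 : ℝ) 1) (hε₂ : ε₂ ∈ Set.Ioc (0 : ℝ) 1)
    (θ : ℝ) (r : ℕ → ℝ) (hr : ∀ k, 0 < r k) (hr_lim : Tendsto r atTop atTop) :
    Homodyne.ConvergesWeaklyInProbabilities
      (fun k => Homodyne.signalObservable b c ε₁ ε₂ (r k * Complex.exp (Complex.I * θ)))
      (Homodyne.smear (Homodyne.smearingMeasure ε₁ ε₂) (Homodyne.rotatedQuadrature b θ)) := by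
  have hprob : IsProbabilityMeasure (Homodyne.smearingMeasure ε₁ ε₂) := by
    rw [Homodyne.smearingMeasure_eq_gaussianReal hε₁ hε₂]; infer_instance
  refine Homodyne.convergesWeaklyInProbabilities_of_charFun
    (fun k => Homodyne.isRepresentedBy_signalObservable b c hε₁ hε₂ _)
    (Homodyne.isRepresentedBy_smear b θ _) fun φ _ t => ?_
  have := Homodyne.isFiniteMeasure_quadratureMeasure b θ φ
  simp_rw [Homodyne.charFun_signal b c hε₁ hε₂]
  -- The Gaussian factor is absorbed as a scalar into the Weyl operator, so that the limit is again
  -- the quadratic form of a single operator.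
  rw [charFun_conv, Homodyne.charFun_smearingMeasure hε₁ hε₂,
    Homodyne.charFun_quadratureMeasure, ← inner_smul_right, ← smul_apply]
  refine Homodyne.tendsto_inner_of_coherent b
    (fun k => Homodyne.norm_signalCharOp_le b c hε₁ hε₂ _ t) (fun α β => ?_) φ φ
  have hε₁' : (ε₁ : ℂ) ≠ 0 := by exact_mod_cast hε₁.1.ne'
  have hε₂' : (ε₂ : ℂ) ≠ 0 := by exact_mod_cast hε₂.1.ne'
  have h2 := Homodyne.ofReal_sqrt_two_mul_self
  have h2' : (√2 : ℂ) ≠ 0 := fun h => by simp [h] at h2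
  have hcj : (starRingEnd ℂ) (Complex.exp (Complex.I * θ)) = Complex.exp (-(Complex.I * θ)) := by
    rw [← Complex.exp_conj]; simp
  have hn : ∀ k, ‖(r k * Complex.exp (Complex.I * θ) : ℂ)‖ = r k := fun k => by
    rw [norm_mul, mul_comm Complex.I, Complex.norm_exp_ofReal_mul_I, mul_one, Complex.norm_real,
      Real.norm_of_nonneg (hr k).le]
  -- The phases per detected photon are exp(a₁/r) and exp(a₂/r). Weighting the counts by 1/ε₁ and
  -- 1/ε₂ is exactly what makes ε₁a₁ + ε₂a₂ = 0.
  have hlim := Homodyne.tendsto_signal_exponent hr_lim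
    (e₁ := ε₁) (e₂ := ε₂) (a₁ := -(t / (√2 * ε₁)) * Complex.I) (a₂ := t / (√2 * ε₂) * Complex.I)
    (by field_simp; ring) ((starRingEnd ℂ) α) β (Complex.exp (Complex.I * θ))
    (Complex.exp (-(Complex.I * θ))) (by rw [← Complex.exp_add, add_neg_cancel, Complex.exp_zero])
  rw [smul_apply, inner_smul_right, Homodyne.inner_rotatedWeyl_coherent, mul_left_comm,
    ← Complex.exp_add]
  simp_rw [Homodyne.inner_signalCharOp_coherent, hn, map_mul, Complex.conj_ofReal, hcj]
  refine Tendsto.const_mul _ ((Complex.continuous_exp.tendsto _).comp ?_)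
  have hd : ∀ x y z w : ℂ, x / (y * z * w) = x / (y * w) / z := fun x y z w => by
    rw [div_div, mul_right_comm]
  convert hlim using 2 with k
  · have e1 : -(t / (√2 * r k * ε₁) : ℂ) * Complex.I = -(t / (√2 * ε₁)) * Complex.I / r k := by
      rw [hd]; ring
    have e2 : (t / (√2 * r k * ε₂) : ℂ) * Complex.I = t / (√2 * ε₂) * Complex.I / r k := by
      rw [hd]; ring
    rw [e1, e2]
  -- Here the variances match: (1/ε₁ + 1/ε₂)/4 is the vacuum variance 1/2 plus `smearingVariance ε₁
  -- ε₂`.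
  · rw [Homodyne.smearingVariance]
    have hs : (√2 : ℂ) ^ 2 = 2 := by rw [sq, h2]
    push_cast
    simp only [mul_pow, neg_pow_two, div_pow, Complex.I_sq, hs]
    field_simp
    ring
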